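/- Let $(\Omega,\mathcal G,\mathbb P)$ be a probability space, let $X\in L^2(\mathbb P)$ take values in $\mathbb X\subseteq\mathbb R$ and have law $\nu$, and let $\beta^{(1)},\dots,\beta^{(n)}$ be standard Brownian bridges on $[0,1]$ (centred Gaussian processes with covariance $\min(s,t)-st$ and continuous paths) such that $X,\beta^{(1)},\dots,\beta^{(n)}$ are mutually independent. For $\sigma_i>0$ put $\xi^{(i)}_t=tX+\sigma_i\beta^{(i)}_t$, and let $(\tilde J_t)_{t\in[0,1]}$ be a càdlàg process with values in $\{0,1\}^n$, independent of $\xi=(\xi^{(1)},\dots,\xi^{(n)})$ (its switching times are the points of a random point field). Let $J_t$ be the diagonal matrix with diagonal $\tilde J_t$, and let $$\mathcal F_t=\sigma\big((J_u\xi_u)_{u\le t},\,(J_u)_{u\le t},\,X\mathbf 1_{\{t=1\}}\big).$$ Let $\mathcal J_t=\{i:\tilde J^{(i)}_t=1\}$ be the set of active sources, and let $\tau^{(i)}_t=0\vee\sup\{u\in[0,t]:\tilde J^{(i)}_u=1\}$, where $\sup\emptyset=-\infty$. Put $$h(x,y,t,\sigma)=\exp\Big(\frac{xy-tx^2/2}{\sigma^2(1-t)}\Big)\quad(\sigma>0),\qquad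 h(x,y,t,0)=1,$$ $$\hat\sigma_t=\Big(\sum_{i\in\mathcal J_t}\sigma_i^{-2}\Big)^{-1/2},\qquad \hat\xi_t=\hat\sigma_t^2\sum_{i\in\mathcal J_t}\sigma_i^{-2}\xi^{(i)}_t\qquad(\hat\sigma_t=\hat\xi_t=0\text{ if }\mathcal J_t=\emptyset),$$ $$\eta_t(x)=\prod_{i\notin\mathcal J_t}h\big(x,\xi^{(i)}_{\tau^{(i)}_t},\tau^{(i)}_t,\sigma_i\big),\qquad x\in\mathbb X.$$ Then for every $t\in[0,1)$ the integral $\int_{\mathbb X}h(x,\hat\xi_t,t,\hat\sigma_t)\,\eta_t(x)\,\nu(\mathrm dx)$ is almost surely positive and finite, and the random measure $$\nu_t(\mathrm dx)=\frac{h(x,\hat\xi_t,t,\hat\sigma_t)\,\eta_t(x)\,\nu(\mathrm dx)}{\int_{\mathbb X}h(y,\hat\xi_t,t,\hat\sigma_t)\,\eta_t(y)\,\nu(\mathrm dy)}$$ is the conditional law $\mathbb P[X\in\mathrm dx\mid\mathcal F_t]$. It is also the conditional law of $X$ given the $t$-th σ-algebra of the right-continuous filtration obtained from $(\mathcal F_s)$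 after adding the null events. Hence $$\nu_t(\mathrm dx)=\mathbb P[X\in\mathrm dx\mid\hat\xi_t,\hat\sigma_t,\eta_t],$$ where the function-valued $\eta_t$ generates the σ-algebra of its evaluations $\eta_t(x)$, $x\in\mathbb X$. In particular, $\nu_t(\mathrm dx)=\mathbb P[X\in\mathrm dx\mid\hat\xi_t,\eta_t]$ holds given the current configuration, that is, under $\mathbb P[\,\cdot\mid\tilde J_t=k]$ for every $k\in\{0,1\}^n$ with $\mathbb P[\tilde J_t=k]>0$; and it holds under $\mathbb P$ itself whenever $\hat\sigma_t$ is almost surely equal to a $\sigma(\hat\xi_t,\eta_t)$-measurable random variable. -/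

import Mathlib

open MeasureTheory ProbabilityTheory Set Filter Topology
open scoped Matrix ENNReal

namespace ModulatedInformation

noncomputable section

/-- A standard Brownian bridge on `[0,1]`: a centred Gaussian process with covariance function
`(s,t) ↦ min s t - s t` and continuous sample paths. -/
structure IsStandardBrownianBridge {Ω : Type*} [MeasurableSpace Ω] (P : Measure Ω)
    (β : unitInterval → Ω → ℝ) : Prop where
  measurable : ∀ t, Measurable (β t)
  gaussian : IsGaussianProcess β P
  mean_zero : ∀ t, P[β t] = 0
  covariance : ∀ s t : unitInterval, cov[β s, β t; P] = min (s : ℝ) t - s * t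
  continuous_paths : ∀ ω, Continuous fun t => β t ω

/-- A càdlàg path: right-continuous with left limits. -/
def IsCadlagPath {E : Type*} [TopologicalSpace E] (f : unitInterval → E) : Prop :=
  ∀ t, ContinuousWithinAt f (Ici t) t ∧ ∃ l, Tendsto f (𝓝[<] t) (𝓝 l)

/-- The information coordinates `ξ⁽ⁱ⁾_t = t X + σᵢ β⁽ⁱ⁾_t`. -/
def infoProcess {Ω : Type*} {𝕏 : Set ℝ} {n : ℕ} (X : Ω → 𝕏) (σ : Fin n → ℝ)
    (β : Fin n → unitInterval → Ω → ℝ) (i : Fin n) (t : unitInterval) (ω : Ω) : ℝ :=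
  t * X ω + σ i * β i t ω

/-- The standing assumptions. The signal `X` takes values in `𝕏 ⊆ ℝ` and is square-integrable;
the `β⁽ⁱ⁾` are standard Brownian bridges; `X, β⁽¹⁾, …, β⁽ⁿ⁾` are mutually independent (the bridges
are mutually independent and `X` is independent of all of them jointly); the switching process `J`
is a càdlàg process with values in `{0,1}ⁿ`, independent of `ξ`. Its coordinates switch finitely
often on `[0,1]`, since they are càdlàg with values in a discrete space; the switching times are
the points of the random point field. -/
structure IsModulatedSystem {Ω : Type*} [MeasurableSpace Ω] (P : Measure Ω) {𝕏 : Set ℝ} {n : ℕ}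
    (X : Ω → 𝕏) (σ : Fin n → ℝ) (β : Fin n → unitInterval → Ω → ℝ) (J : unitInterval → Ω → Fin n → Bool) : Prop where
  measurable_signal : Measurable X
  memLp_signal : MemLp (fun ω => (X ω : ℝ)) 2 P
  sigma_pos : ∀ i, 0 < σ i
  bridge : ∀ i, IsStandardBrownianBridge P (β i)
  indep_bridges : iIndepFun (fun i ω (s : unitInterval) => β i s ω) P
  indep_signal : IndepFun X (fun ω i (s : unitInterval) => β i s ω) P
  measurable_switch : ∀ t, Measurable (J t)
  cadlag_switch : ∀ ω, IsCadlagPath fun t => J t ω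
  indep_switch : IndepFun (fun ω (s : unitInterval) => J s ω) (fun ω i (s : unitInterval) => infoProcess X σ β i s ω) P

/-- The diagonal matrix `J_t` with diagonal entries given by the switching process. -/
def switchMatrix {n : ℕ} (j : Fin n → Bool) : Matrix (Fin n) (Fin n) ℝ :=
  Matrix.diagonal fun i => if j i then 1 else 0

/-- `F_t = σ((J_u ξ_u)_{u ≤ t}, (J_u)_{u ≤ t}, X 1_{t = 1})`. -/
@[reducible] def observed {Ω : Type*} {𝕏 : Set ℝ} {n : ℕ} (X : Ω → 𝕏) (σ : Fin n → ℝ)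
    (β : Fin n → unitInterval → Ω → ℝ) (J : unitInterval → Ω → Fin n → Bool) (t : unitInterval) : MeasurableSpace Ω :=
  (⨆ u ≤ t, MeasurableSpace.comap
      (fun ω => switchMatrix (J u ω) *ᵥ fun i => infoProcess X σ β i u ω) inferInstance) ⊔
  (⨆ u ≤ t, MeasurableSpace.comap (J u) inferInstance) ⊔
  MeasurableSpace.comap (fun ω => if t = 1 then (X ω : ℝ) else 0) inferInstance

/-- The σ-algebra generated by the `P`-null events. -/
@[reducible] def nullEvents {Ω : Type*} [MeasurableSpace Ω] (P : Measure Ω) : MeasurableSpace Ω :=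
  MeasurableSpace.generateFrom {N | MeasurableSet N ∧ P N = 0}

/-- The usual augmentation of a family of σ-algebras on `[0,1]`: null events are added and the
result is made right-continuous. The first term matters only at `t = 1`. -/
@[reducible] def usualAugmentation {Ω : Type*} [MeasurableSpace Ω] (P : Measure Ω)
    (F : unitInterval → MeasurableSpace Ω) (t : unitInterval) : MeasurableSpace Ω :=
  (F 1 ⊔ nullEvents P) ⊓ ⨅ s > t, (F s ⊔ nullEvents P)

/-- The last time before `t` at which a source has been active, `0` if there is none: `a` is the
path of the activity of the source, and the supremum is taken in `[0,1]`. -/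
def lastActive (a : unitInterval → Bool) (t : unitInterval) : unitInterval := sSup {u | u ≤ t ∧ a u = true}

/-- `h(x, y, t, σ) = exp((x y - t x² / 2) / (σ² (1 - t)))`, with the convention
`h(x, y, t, 0) = 1` (no active source). -/
def h (x y t σ : ℝ) : ℝ :=
  if σ = 0 then 1 else Real.exp ((x * y - t * x ^ 2 / 2) / (σ ^ 2 * (1 - t)))

/-- The set of active sources in a configuration. -/
def active {n : ℕ} (j : Fin n → Bool) : Finset (Fin n) := {i | j i = true}

/-- The effective volatility parameter of a configuration. -/
def effVol {n : ℕ} (σ : Fin n → ℝ) (j : Fin n → Bool) : ℝ :=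
  if active j = ∅ then 0 else (∑ i ∈ active j, (σ i ^ 2)⁻¹) ^ (-(1 / 2) : ℝ)

/-- The effective information process (`0` if no source is active). -/
def effInfo {Ω : Type*} {𝕏 : Set ℝ} {n : ℕ} (X : Ω → 𝕏) (σ : Fin n → ℝ)
    (β : Fin n → unitInterval → Ω → ℝ) (J : unitInterval → Ω → Fin n → Bool) (t : unitInterval) (ω : Ω) : ℝ :=
  effVol σ (J t ω) ^ 2 * ∑ i ∈ active (J t ω), (σ i ^ 2)⁻¹ * infoProcess X σ β i t ω

/-- The complementary information process, with values in the functions on `𝕏`. -/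
def compInfo {Ω : Type*} {𝕏 : Set ℝ} {n : ℕ} (X : Ω → 𝕏) (σ : Fin n → ℝ)
    (β : Fin n → unitInterval → Ω → ℝ) (J : unitInterval → Ω → Fin n → Bool) (t : unitInterval) (ω : Ω) (x : 𝕏) : ℝ :=
  ∏ i ∈ (active (J t ω))ᶜ,
    h x (infoProcess X σ β i (lastActive (fun u => J u ω i) t) ω)
      (lastActive (fun u => J u ω i) t) (σ i)

/-- The unnormalised density `x ↦ h(x, ξ̂_t, t, σ̂_t) η_t(x)`. -/
def weight {Ω : Type*} {𝕏 : Set ℝ} {n : ℕ} (X : Ω → 𝕏) (σ : Fin n → ℝ)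
    (β : Fin n → unitInterval → Ω → ℝ) (J : unitInterval → Ω → Fin n → Bool) (t : unitInterval) (ω : Ω) (x : 𝕏) : ℝ :=
  h x (effInfo X σ β J t ω) t (effVol σ (J t ω)) * compInfo X σ β J t ω x

/-- The normalising integral of `weight` with respect to the law `ν` of `X`. -/
def normalizer {Ω : Type*} [MeasurableSpace Ω] (P : Measure Ω) {𝕏 : Set ℝ} {n : ℕ} (X : Ω → 𝕏)
    (σ : Fin n → ℝ) (β : Fin n → unitInterval → Ω → ℝ) (J : unitInterval → Ω → Fin n → Bool) (t : unitInterval) (ω : Ω) : ℝ≥0∞ :=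
  ∫⁻ x, ENNReal.ofReal (weight X σ β J t ω x) ∂(P.map X)

/-- The random measure `h(x, ξ̂_t, t, σ̂_t) η_t(x) ν(dx) / ∫ h(x, ξ̂_t, t, σ̂_t) η_t(x) ν(dx)`,
where `ν` is the law of `X`. -/
def posterior {Ω : Type*} [MeasurableSpace Ω] (P : Measure Ω) {𝕏 : Set ℝ} {n : ℕ} (X : Ω → 𝕏)
    (σ : Fin n → ℝ) (β : Fin n → unitInterval → Ω → ℝ) (J : unitInterval → Ω → Fin n → Bool) (t : unitInterval) (ω : Ω) :
    Measure 𝕏 :=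
  (normalizer P X σ β J t ω)⁻¹ •
    (P.map X).withDensity fun x => ENNReal.ofReal (weight X σ β J t ω x)

/-- The σ-algebra generated by the effective information and the complementary information at
time `t`; functions on `𝕏` carry the product σ-algebra. -/
@[reducible] def effCompInfo {Ω : Type*} {𝕏 : Set ℝ} {n : ℕ} (X : Ω → 𝕏) (σ : Fin n → ℝ)
    (β : Fin n → unitInterval → Ω → ℝ) (J : unitInterval → Ω → Fin n → Bool) (t : unitInterval) :
    MeasurableSpace Ω :=
  MeasurableSpace.comap (effInfo X σ β J t) inferInstance ⊔
    MeasurableSpace.comap (compInfo X σ β J t) inferInstance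

/-- `κ` is a (version of the) conditional law of `X` given the sub-σ-algebra `m`. -/
def IsCondLaw {Ω : Type*} [mΩ : MeasurableSpace Ω] (P : Measure Ω) {𝕏 : Set ℝ} (X : Ω → 𝕏)
    (m : MeasurableSpace Ω) (κ : Ω → Measure 𝕏) : Prop :=
  m ≤ mΩ ∧ (∀ᵐ ω ∂P, IsProbabilityMeasure (κ ω)) ∧
    ∀ A : Set 𝕏, MeasurableSet A → P⟦X ⁻¹' A | m⟧ =ᵐ[P] fun ω => (κ ω).real A

end

end ModulatedInformation

/-! The theorem is Bayes' formula for a record that is richer than the observations: `infoRecord`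
keeps the whole switching path and each source stopped at the last time before `t` at which it was
active.

Freeze the signal value `x` and the switching path, so that the stopping times `τ` are
deterministic. A stopped bridge is the linear interpolation of its value at `τ` plus a remainder
independent of that value (`indepFun_bridge`). The drift `(u ∧ τ) x` is linear in `u ∧ τ`, hence
shifts only the value at `τ`, which is Gaussian with variance `σ² τ (1 - τ)`; the Cameron–Martin
density of this shift is exactly `h`. Independence of the bridges gives a product of such factors,
so the joint law of signal and record has density `likelihood` with respect to the product of the
law of the signal and the law of the pure-noise record (`lintegral_signal_infoRecord`). Precisions
add, so the factors of the active sources merge into one factor with the effective parameters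
(`h_effInfo`, `weight_eq`).

Bayes' formula on the σ-algebra of the record restricts to every smaller σ-algebra with respect to
which the posterior has a measurable version (`isCondLaw_of_setLIntegral`). The observations
suffice: the posterior depends only on the last active times and the values there, which are limits
of observed quantities. The effective and complementary information suffice once the effective
volatility is known.

The augmented σ-algebra need not lie below the record at `t`. There, Bayes' formula is used at times
`s > t` and `s ↓ t` is taken by dominated convergence. Domination of the weights is available only
for bounded signal values, so Bayes' formula is first localised to a bounded set `B`, and `B` is
then exhausted. -/

namespace ModulatedInformation

/-! ### Gaussian shifts and the stopped Brownian bridge. -/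

/-- The Cameron–Martin formula for a Gaussian law on the real line. -/
lemma gaussianReal_withDensity_exp (c : ℝ) (v : NNReal) :
    (gaussianReal 0 v).withDensity (fun y => ENNReal.ofReal (Real.exp (c * y - c ^ 2 * v / 2))) =
      gaussianReal (c * v) v := by
  -- Zero variance does occur: a source that has never been active is stopped at time `0`.
  by_cases hv : v = 0
  · classical
    subst hv
    ext s hs
    rw [gaussianReal_zero_var, withDensity_apply _ hs, restrict_dirac' hs]
    split_ifs with h <;> simp [h, hs]
  · have hv' : (v : ℝ) ≠ 0 := by exact_mod_cast hv
    rw [gaussianReal_of_var_ne_zero _ hv, gaussianReal_of_var_ne_zero _ hv,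
      ← withDensity_mul _ (measurable_gaussianPDF 0 v) (by fun_prop)]
    congr 1
    ext y
    simp only [Pi.mul_apply, gaussianPDF, gaussianPDFReal]
    rw [← ENNReal.ofReal_mul (by positivity), mul_assoc, ← Real.exp_add]
    congr 3
    field_simp
    ring

lemma lintegral_gaussianReal_shift (c : ℝ) (v : NNReal) {g : ℝ → ℝ≥0∞} (hg : Measurable g) :
    ∫⁻ y, g (c * v + y) ∂(gaussianReal 0 v) =
      ∫⁻ y, g y * ENNReal.ofReal (Real.exp (c * y - c ^ 2 * v / 2)) ∂(gaussianReal 0 v) := by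
  have h1 : (gaussianReal 0 v).map (fun y => c * v + y) = gaussianReal (c * v) v := by
    rw [gaussianReal_map_const_add, zero_add]
  rw [← lintegral_map hg (by fun_prop), h1, ← gaussianReal_withDensity_exp,
    lintegral_withDensity_eq_lintegral_mul _ (by fun_prop) hg]
  simp [mul_comm]

/-- Boxes determine the measure, and on a box the integral of the product density factorises because
the coordinates are independent under `Measure.pi μ`. -/
lemma pi_withDensity {ι : Type*} [Fintype ι] {E : ι → Type*} [∀ i, MeasurableSpace (E i)]
    (μ : ∀ i, Measure (E i)) [∀ i, IsProbabilityMeasure (μ i)] (f : ∀ i, E i → ℝ≥0∞)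
    (hf : ∀ i, Measurable (f i)) [∀ i, IsProbabilityMeasure ((μ i).withDensity (f i))] :
    Measure.pi (fun i => (μ i).withDensity (f i)) =
      (Measure.pi μ).withDensity fun x => ∏ i, f i (x i) := by
  refine Measure.pi_eq fun s hs => ?_
  have hind : iIndepFun (fun i (x : ∀ i, E i) => (s i).indicator (f i) (x i)) (Measure.pi μ) :=
    iIndepFun_pi (X := fun i => (s i).indicator (f i))
      fun i => ((hf i).indicator (hs i)).aemeasurable
  have key := lintegral_prod_eq_prod_lintegral_of_indepFun Finset.univ _ hind
    fun i => ((hf i).indicator (hs i)).comp (measurable_pi_apply i)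
  rw [withDensity_apply _ (MeasurableSet.univ_pi hs), ← lintegral_indicator (MeasurableSet.univ_pi hs)]
  calc _ = ∫⁻ x, ∏ i, (s i).indicator (f i) (x i) ∂(Measure.pi μ) := by
        congr 1
        ext x
        by_cases hx : x ∈ univ.pi s
        · rw [indicator_of_mem hx]
          exact Finset.prod_congr rfl fun i _ => (indicator_of_mem (hx i (mem_univ i)) _).symm
        · rw [indicator_of_notMem hx]
          simp only [mem_univ_pi, not_forall] at hx
          obtain ⟨i, hi⟩ := hx
          exact (Finset.prod_eq_zero (Finset.mem_univ i) (indicator_of_notMem hi _)).symm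
    _ = _ := key
    _ = _ := by
        refine Finset.prod_congr rfl fun i _ => ?_
        rw [withDensity_apply _ (hs i), ← lintegral_indicator (hs i)]
        exact (measurePreserving_eval μ i).lintegral_comp ((hf i).indicator (hs i))

variable {Ω : Type*} [MeasurableSpace Ω] {P : Measure Ω}

lemma IsStandardBrownianBridge.map_eq {β : unitInterval → Ω → ℝ}
    (hβ : IsStandardBrownianBridge P β) (s : unitInterval) (c : ℝ) :
    P.map (fun ω => c * β s ω) =
      gaussianReal 0 (c ^ 2 * (s * (1 - s))).toNNReal := by
  have hg : HasGaussianLaw (fun ω => c * β s ω) P :=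
    (hβ.gaussian.smul fun _ => c).hasGaussianLaw_eval s
  have := hβ.gaussian.isProbabilityMeasure
  rw [hg.map_eq_gaussianReal]
  congr 1
  · rw [integral_const_mul, hβ.mean_zero, mul_zero]
  · congr 1
    rw [variance_const_mul, ← covariance_self (hβ.measurable s).aemeasurable, hβ.covariance]
    simp only [min_self]
    ring

/-- The variance vanishes. At `s = 1` this identifies `ξ₁` with the signal, at `s = 0` it gives `ξ₀
= 0`. -/
lemma IsStandardBrownianBridge.ae_eq_zero {β : unitInterval → Ω → ℝ}
    (hβ : IsStandardBrownianBridge P β) {s : unitInterval} (hs : (s : ℝ) * (1 - s) = 0) :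
    ∀ᵐ ω ∂P, β s ω = 0 := by
  have h := hβ.map_eq s 1
  simp only [one_mul, one_pow, hs, Real.toNNReal_zero, gaussianReal_zero_var] at h
  have h0 : ∀ᵐ y ∂(P.map (β s)), y = 0 := by
    have h' : P.map (β s) = Measure.dirac 0 := h
    rw [h', ae_dirac_iff (measurableSet_eq)]
  exact ae_of_ae_map (hβ.measurable s).aemeasurable h0

/-- For `v ≤ τ` the covariance of `β τ` and `β v` is `v (1 - τ)`, which is `v / τ` times the
variance of `β τ`. The remainder is therefore uncorrelated with `β τ`, and joint Gaussianity
upgrades this to independence. -/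
lemma IsStandardBrownianBridge.indepFun_bridge {β : unitInterval → Ω → ℝ}
    (hβ : IsStandardBrownianBridge P β) (τ : unitInterval) (c : ℝ) :
    IndepFun (fun ω => c * β τ ω)
      (fun ω (u : unitInterval) => c * β (min u τ) ω - (min u τ : unitInterval) / (τ : ℝ) * (c * β τ ω)) P := by
  have := hβ.gaussian.isProbabilityMeasure
  have hG : IsGaussianProcess (Sum.elim (fun (_ : Unit) ω => c * β τ ω)
      (fun (u : unitInterval) ω => c * β (min u τ) ω - (min u τ : unitInterval) / (τ : ℝ) * (c * β τ ω))) P := by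
    classical
    refine hβ.gaussian.of_isGaussianProcess fun s => ?_
    rcases s with _ | u
    · exact ⟨{τ}, c • ContinuousLinearMap.proj ⟨τ, by simp⟩, fun ω => by simp⟩
    · exact ⟨{min u τ, τ}, c • ContinuousLinearMap.proj ⟨min u τ, by simp⟩ -
        ((min u τ : unitInterval) / (τ : ℝ) * c) • ContinuousLinearMap.proj ⟨τ, by simp⟩,
        fun ω => by simp; ring⟩
  have hm := hβ.measurable
  have hL : ∀ s, MemLp (β s) 2 P := fun s => (hβ.gaussian.hasGaussianLaw_eval s).memLp_two
  have := hG.indepFun_of_covariance_eq_zero (fun _ => by fun_prop) (fun _ => by fun_prop)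
    fun _ u => ?_
  · have hφ : Measurable fun f : Unit → ℝ => f () := measurable_pi_apply ()
    exact this.comp hφ measurable_id
  · rw [covariance_const_mul_left]
    rw [covariance_fun_sub_right (hL _) ((hL _).const_mul _) (((hL _).const_mul _).const_mul _),
      covariance_const_mul_right, covariance_const_mul_right, covariance_const_mul_right,
      hβ.covariance, hβ.covariance]
    -- At `τ = 0` the quotient is `0` by convention and all covariances vanish.
    by_cases hτ : (τ : ℝ) = 0
    · have : τ = 0 := Subtype.ext hτ
      subst this
      simp
    · have h1 : (min u τ : unitInterval) ≤ τ := min_le_right _ _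
      have h2 : min (τ : ℝ) (min u τ : unitInterval) = (min u τ : unitInterval) :=
        min_eq_right h1
      rw [h2, min_self]
      field_simp
      ring

/-- Adding a drift to a stopped Brownian bridge changes its law by the density `h`. -/
lemma IsStandardBrownianBridge.lintegral_shift {β : unitInterval → Ω → ℝ}
    (hβ : IsStandardBrownianBridge P β) {τ : unitInterval} (hτ : τ < 1) {σ : ℝ} (hσ : 0 < σ)
    (x : ℝ) {G : (unitInterval → ℝ) → ℝ≥0∞} (hG : Measurable G) :
    ∫⁻ ω, G (fun u => (min u τ : unitInterval) * x + σ * β (min u τ) ω) ∂P =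
      ∫⁻ ω, G (fun u => σ * β (min u τ) ω) * ENNReal.ofReal (h x (σ * β τ ω) τ σ) ∂P := by
  have := hβ.gaussian.isProbabilityMeasure
  have hm := hβ.measurable
  have hτ' : (τ : ℝ) < 1 := hτ
  have hτ0 : 0 ≤ (τ : ℝ) := τ.2.1
  set B : Ω → ℝ := fun ω => σ * β τ ω with hB
  set Z : Ω → unitInterval → ℝ := fun ω u =>
    σ * β (min u τ) ω - (min u τ : unitInterval) / (τ : ℝ) * (σ * β τ ω) with hZ
  have hBm : Measurable B := by fun_prop
  have hZm : Measurable Z := measurable_pi_lambda _ fun u => by simp only [hZ]; fun_prop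
  have hind : IndepFun B Z P := hβ.indepFun_bridge τ σ
  have hlaw := (indepFun_iff_map_prod_eq_prod_map_map hBm.aemeasurable hZm.aemeasurable).1 hind
  have hmarg := hβ.map_eq τ σ
  set v := (σ ^ 2 * (τ * (1 - τ)) : ℝ).toNNReal with hv
  have hvc : (v : ℝ) = σ ^ 2 * (τ * (1 - τ)) :=
    Real.coe_toNNReal _ (mul_nonneg (sq_nonneg _) (mul_nonneg hτ0 (by linarith)))
  -- Chosen so that `c * v = τ * x` is the drift accumulated at `τ`; the Cameron–Martin exponent
  -- then equals that of `h`.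
  set c : ℝ := x / (σ ^ 2 * (1 - τ)) with hc
  have hcv : c * v = τ * x := by
    rw [hvc, hc]
    have : 1 - (τ : ℝ) ≠ 0 := by linarith
    field_simp
  -- Rebuilds the stopped path from its final value and the remainder; adding the drift only
  -- translates the first argument.
  let Φ : ℝ × (unitInterval → ℝ) → unitInterval → ℝ := fun p u =>
    (min u τ : unitInterval) / (τ : ℝ) * p.1 + p.2 u
  have hΦ : Measurable Φ := measurable_pi_lambda _ fun u => by fun_prop
  have hh : ∀ y, h x y τ σ = Real.exp (c * y - c ^ 2 * v / 2) := fun y => by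
    rw [h, if_neg hσ.ne', hvc, hc]
    have : 1 - (τ : ℝ) ≠ 0 := by linarith
    congr 1
    field_simp
  have hhm : Measurable fun y => ENNReal.ofReal (h x y τ σ) := by
    simp only [hh]; fun_prop
  have e1 : ∀ ω, (fun u => (min u τ : unitInterval) * x + σ * β (min u τ) ω) =
      Φ (c * v + B ω, Z ω) := fun ω => by
    ext u
    simp only [Φ, hB, hZ, hcv]
    have : (min u τ : unitInterval) / (τ : ℝ) * (τ * x) = (min u τ : unitInterval) * x := by
      by_cases h0 : (τ : ℝ) = 0
      · have : τ = 0 := Subtype.ext h0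
        subst this
        simp
      · field_simp
    rw [mul_add, this]
    ring
  have e2 : ∀ ω, (fun u => σ * β (min u τ) ω) = Φ (B ω, Z ω) := fun ω => by
    ext u
    simp only [Φ, hB, hZ]
    ring
  have m1 : Measurable fun p : ℝ × (unitInterval → ℝ) => G (Φ (c * v + p.1, p.2)) :=
    hG.comp (hΦ.comp (by fun_prop))
  have m2 : Measurable fun p : ℝ × (unitInterval → ℝ) =>
      G (Φ p) * ENNReal.ofReal (h x p.1 τ σ) := (hG.comp hΦ).mul (hhm.comp measurable_fst)
  have hPB : IsProbabilityMeasure (P.map B) := Measure.isProbabilityMeasure_map hBm.aemeasurable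
  have hPZ : IsProbabilityMeasure (P.map Z) := Measure.isProbabilityMeasure_map hZm.aemeasurable
  calc _ = ∫⁻ p, G (Φ (c * v + p.1, p.2)) ∂(P.map fun ω => (B ω, Z ω)) := by
        rw [lintegral_map m1 (hBm.prodMk hZm)]
        simp only [e1]
    _ = ∫⁻ z, ∫⁻ b, G (Φ (c * v + b, z)) ∂(P.map B) ∂(P.map Z) := by
        rw [hlaw, lintegral_prod_symm _ m1.aemeasurable]
    _ = ∫⁻ z, ∫⁻ b, G (Φ (b, z)) * ENNReal.ofReal (h x b τ σ) ∂(P.map B) ∂(P.map Z) := by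
        congr 1
        ext z
        rw [hB, hmarg, lintegral_gaussianReal_shift c v (g := fun b => G (Φ (b, z)))
          (hG.comp (hΦ.comp (by fun_prop)))]
        simp only [hh]
    _ = ∫⁻ p, G (Φ p) * ENNReal.ofReal (h x p.1 τ σ) ∂(P.map fun ω => (B ω, Z ω)) := by
        rw [hlaw, lintegral_prod_symm _ m2.aemeasurable]
    _ = _ := by
        rw [lintegral_map m2 (hBm.prodMk hZm)]
        simp only [e2, hB]

end ModulatedInformation

/-! ### Last active times, observation records and their measurability. -/

namespace ModulatedInformation

lemma measurable_h : Measurable fun p : ℝ × ℝ × ℝ × ℝ => h p.1 p.2.1 p.2.2.1 p.2.2.2 := by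
  unfold h
  refine Measurable.ite (measurableSet_eq_fun (by fun_prop) (by fun_prop)) (by fun_prop) ?_
  fun_prop

lemma measurable_h_comp {α : Type*} [MeasurableSpace α] {x y t s : α → ℝ} (hx : Measurable x)
    (hy : Measurable y) (ht : Measurable t) (hs : Measurable s) :
    Measurable fun a => h (x a) (y a) (t a) (s a) :=
  measurable_h.comp (hx.prodMk (hy.prodMk (ht.prodMk hs)))

lemma h_pos (x y t s : ℝ) : 0 < h x y t s := by
  unfold h
  split_ifs
  · exact one_pos
  · exact Real.exp_pos _

lemma lastActive_le (a : unitInterval → Bool) (t : unitInterval) : lastActive a t ≤ t :=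
  sSup_le fun _ hu => hu.1

lemma le_lastActive {a : unitInterval → Bool} {u t : unitInterval} (hu : u ≤ t) (ha : a u = true) :
    u ≤ lastActive a t :=
  le_sSup ⟨hu, ha⟩

lemma lastActive_eq_self {a : unitInterval → Bool} {t : unitInterval} (ha : a t = true) :
    lastActive a t = t :=
  le_antisymm (lastActive_le a t) (le_lastActive le_rfl ha)

/-- A sequence of times that is dense in `[0,t]` and visits `t`. -/
noncomputable def denseTime (t : unitInterval) (k : ℕ) : unitInterval :=
  min (TopologicalSpace.denseSeq unitInterval k) t

lemma denseTime_le (t : unitInterval) (k : ℕ) : denseTime t k ≤ t := min_le_right _ _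

/-- By right-continuity a source active at `u < t` stays active for a while, and a dense time falls
into that stretch. -/
lemma exists_denseTime {t : unitInterval} (ht : t < 1) {a : unitInterval → Bool}
    (ha : ∀ s, ContinuousWithinAt a (Ici s) s) {u : unitInterval} (hu : u ≤ t) (hau : a u = true) :
    ∃ k, u ≤ denseTime t k ∧ a (denseTime t k) = true := by
  have hd := TopologicalSpace.denseRange_denseSeq unitInterval
  rcases hu.eq_or_lt with rfl | hut
  -- A dense point beyond `t` is truncated to `t` itself; such a point exists because `t < 1`.
  · obtain ⟨k, hk⟩ := hd.exists_mem_open isOpen_Ioi ⟨1, ht⟩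
    have : denseTime u k = u := min_eq_right (le_of_lt hk)
    exact ⟨k, by rw [this], by rw [this, hau]⟩
  · have h1 : ∀ᶠ s in 𝓝[≥] u, a s = true := by
      have := (ha u).eventually_mem ((isOpen_discrete {a u}).mem_nhds rfl)
      filter_upwards [this] with s hs
      rw [← hau]
      exact hs
    obtain ⟨v, hv, hv'⟩ := (mem_nhdsGE_iff_exists_Ico_subset' hut).1 h1
    obtain ⟨k, hk⟩ := hd.exists_mem_open (isOpen_Ioo (a := u) (b := min v t))
      (nonempty_Ioo.2 (lt_min hv hut))
    have : denseTime t k = TopologicalSpace.denseSeq unitInterval k :=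
      min_eq_left (hk.2.le.trans (min_le_right _ _))
    rw [← this] at hk
    exact ⟨k, hk.1.le, hv' ⟨hk.1.le, hk.2.trans_le (min_le_left _ _)⟩⟩

/-- Replaces an uncountable supremum by a countable one, which makes the last active time
measurable. -/
lemma lastActive_eq_iSup {t : unitInterval} (ht : t < 1) {a : unitInterval → Bool}
    (ha : ∀ s, ContinuousWithinAt a (Ici s) s) :
    lastActive a t = ⨆ k, if a (denseTime t k) = true then denseTime t k else 0 := by
  refine le_antisymm (sSup_le fun u hu => ?_) (iSup_le fun k => ?_)
  · obtain ⟨k, hk, hak⟩ := exists_denseTime ht ha hu.1 hu.2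
    refine hk.trans (le_iSup_of_le k ?_)
    rw [if_pos hak]
  · split_ifs with hk
    · exact le_lastActive (denseTime_le t k) hk
    · exact bot_le

lemma measurable_lastActive {Ω : Type*} {m : MeasurableSpace Ω} {t : unitInterval} (ht : t < 1)
    {a : Ω → unitInterval → Bool} (ha : ∀ u ≤ t, Measurable fun ω => a ω u)
    (hcont : ∀ ω s, ContinuousWithinAt (a ω) (Ici s) s) :
    Measurable fun ω => lastActive (a ω) t := by
  simp only [fun ω => lastActive_eq_iSup ht (hcont ω)]
  exact Measurable.iSup fun k => Measurable.ite
    (ha _ (denseTime_le t k) (measurableSet_singleton true)) measurable_const measurable_const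

lemma IsCadlagPath.continuousWithinAt_apply {n : ℕ} {j : unitInterval → Fin n → Bool}
    (hj : IsCadlagPath j) (i : Fin n) (s : unitInterval) :
    ContinuousWithinAt (fun u => j u i) (Ici s) s :=
  (continuous_apply i).continuousAt.comp_continuousWithinAt (hj s).1

/-- The paths of the switching process. -/
abbrev SwitchPath (n : ℕ) : Type := {j : unitInterval → Fin n → Bool // IsCadlagPath j}

/-- Continuous paths, with the σ-algebra of the evaluations. -/
abbrev CPath : Type := {f : unitInterval → ℝ // Continuous f}

/-- The last time before `t` at which the source `i` has been active. -/
noncomputable abbrev SwitchPath.last {n : ℕ} (j : SwitchPath n) (t : unitInterval) (i : Fin n) : unitInterval :=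
  lastActive (fun u => j.1 u i) t

lemma measurable_activity {n : ℕ} (u : unitInterval) (i : Fin n) :
    Measurable fun j : SwitchPath n => j.1 u i :=
  (measurable_pi_apply i).comp ((measurable_pi_apply u).comp measurable_subtype_coe)

lemma measurable_last {n : ℕ} {t : unitInterval} (ht : t < 1) (i : Fin n) :
    Measurable fun j : SwitchPath n => j.last t i :=
  measurable_lastActive ht (fun u _ => measurable_activity u i)
    fun j => j.2.continuousWithinAt_apply i

/-- Continuity of the paths makes evaluation jointly measurable, so that a source can be read at a
random time. This is the purpose of the subtype `CPath`. -/
lemma measurable_cpath_eval : Measurable fun p : unitInterval × CPath => p.2.1 p.1 :=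
  measurable_uncurry_of_continuous_of_measurable (u := fun u (f : CPath) => f.1 u)
    (fun f => f.2) fun u => (measurable_pi_apply u).comp measurable_subtype_coe

/-- Observation records: the switching path and the paths of the sources, stopped at the time of
the last observation. -/
abbrev ObsRecord (n : ℕ) : Type := SwitchPath n × (Fin n → unitInterval → ℝ)

/-- The record up to time `t` of sources with paths `f` under the switching path `j`. -/
noncomputable def record {n : ℕ} (t : unitInterval) (j : SwitchPath n) (f : Fin n → unitInterval → ℝ) :
    ObsRecord n :=
  (j, fun i u => f i (min u (j.last t i)))

/-- The likelihood of the signal value `x` given a record. -/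
noncomputable def likelihood {n : ℕ} (σ : Fin n → ℝ) (t : unitInterval) (x : ℝ) (r : ObsRecord n) : ℝ :=
  -- The value at `1` of a stopped path is its value at the stopping time.
  ∏ i, h x (r.2 i 1) (r.1.last t i) (σ i)

lemma likelihood_pos {n : ℕ} (σ : Fin n → ℝ) (t : unitInterval) (x : ℝ) (r : ObsRecord n) :
    0 < likelihood σ t x r :=
  Finset.prod_pos fun _ _ => h_pos _ _ _ _

lemma measurable_likelihood {n : ℕ} (σ : Fin n → ℝ) {t : unitInterval} (ht : t < 1) :
    Measurable fun p : ℝ × ObsRecord n => likelihood σ t p.1 p.2 := by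
  unfold likelihood
  refine Finset.measurable_prod _ fun i _ => measurable_h_comp measurable_fst ?_ ?_ measurable_const
  · exact (measurable_pi_apply 1).comp ((measurable_pi_apply i).comp (measurable_snd.comp measurable_snd))
  · exact measurable_subtype_coe.comp
      ((measurable_last ht i).comp (measurable_fst.comp measurable_snd))

lemma measurable_record_affine {n : ℕ} (σ : Fin n → ℝ) {t : unitInterval} (ht : t < 1) :
    Measurable fun p : SwitchPath n × ℝ × (Fin n → CPath) =>
      record t p.1 fun i u => u * p.2.1 + σ i * (p.2.2 i).1 u := by
  refine measurable_fst.prodMk (measurable_pi_lambda _ fun i => measurable_pi_lambda _ fun u => ?_)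
  have hmin : Measurable fun p : SwitchPath n × ℝ × (Fin n → CPath) => min u (p.1.last t i) :=
    measurable_const.min ((measurable_last ht i).comp measurable_fst)
  refine ((measurable_subtype_coe.comp hmin).mul (by fun_prop)).add (measurable_const.mul ?_)
  exact measurable_cpath_eval.comp (hmin.prodMk (by fun_prop))

variable {Ω : Type*} [MeasurableSpace Ω] {P : Measure Ω} {𝕏 : Set ℝ} {n : ℕ} {X : Ω → 𝕏}
  {σ : Fin n → ℝ} {β : Fin n → unitInterval → Ω → ℝ} {J : unitInterval → Ω → Fin n → Bool}

/-- With the switching path frozen, the times `τ` are deterministic. Independence of the bridges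
multiplies the one-source densities. -/
lemma lintegral_shift_stopped [IsProbabilityMeasure P]
    (hβ : ∀ i, IsStandardBrownianBridge P (β i))
    (hind : iIndepFun (fun i ω (s : unitInterval) => β i s ω) P) (hσ : ∀ i, 0 < σ i)
    {τ : Fin n → unitInterval} (hτ : ∀ i, τ i < 1) (x : ℝ)
    {G : (Fin n → unitInterval → ℝ) → ℝ≥0∞} (hG : Measurable G) :
    ∫⁻ ω, G (fun i u => (min u (τ i) : unitInterval) * x + σ i * β i (min u (τ i)) ω) ∂P =
      ∫⁻ ω, G (fun i u => σ i * β i (min u (τ i)) ω) *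
        ∏ i, ENNReal.ofReal (h x (σ i * β i (τ i) ω) (τ i) (σ i)) ∂P := by
  have hm := fun i => (hβ i).measurable
  let V : Fin n → Ω → unitInterval → ℝ := fun i ω u =>
    (min u (τ i) : unitInterval) * x + σ i * β i (min u (τ i)) ω
  let W : Fin n → Ω → unitInterval → ℝ := fun i ω u => σ i * β i (min u (τ i)) ω
  let f : Fin n → (unitInterval → ℝ) → ℝ≥0∞ := fun i p => ENNReal.ofReal (h x (p 1) (τ i) (σ i))
  have hV : ∀ i, Measurable (V i) := fun i => measurable_pi_lambda _ fun u => by fun_prop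
  have hW : ∀ i, Measurable (W i) := fun i => measurable_pi_lambda _ fun u => by fun_prop
  have hf : ∀ i, Measurable (f i) := fun i => ENNReal.measurable_ofReal.comp
    (measurable_h_comp measurable_const (measurable_pi_apply 1) measurable_const measurable_const)
  have iV : iIndepFun V P := hind.comp
    (fun i p u => (min u (τ i) : unitInterval) * x + σ i * p (min u (τ i)))
    fun i => measurable_pi_lambda _ fun u => by fun_prop
  have iW : iIndepFun W P := hind.comp
    (fun i p u => σ i * p (min u (τ i)))
    fun i => measurable_pi_lambda _ fun u => by fun_prop
  have hlaw : ∀ i, P.map (V i) = (P.map (W i)).withDensity (f i) := fun i => by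
    ext s hs
    rw [withDensity_apply _ hs, ← lintegral_indicator_one hs, ← lintegral_indicator hs,
      lintegral_map (measurable_one.indicator hs) (hV i),
      lintegral_map ((hf i).indicator hs) (hW i)]
    refine ((hβ i).lintegral_shift (hτ i) (hσ i) x (measurable_one.indicator hs)).trans ?_
    refine lintegral_congr fun ω => ?_
    have h1 : W i ω 1 = σ i * β i (τ i) ω := by
      simp only [W]
      rw [min_eq_right (show τ i ≤ 1 from le_top)]
    by_cases hω : W i ω ∈ s
    · rw [indicator_of_mem hω, indicator_of_mem hω, Pi.one_apply, one_mul, ← h1]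
    · rw [indicator_of_notMem hω, indicator_of_notMem hω, zero_mul]
  have pV : ∀ i, IsProbabilityMeasure (P.map (V i)) :=
    fun i => Measure.isProbabilityMeasure_map (hV i).aemeasurable
  have pW : ∀ i, IsProbabilityMeasure (P.map (W i)) :=
    fun i => Measure.isProbabilityMeasure_map (hW i).aemeasurable
  have pf : ∀ i, IsProbabilityMeasure ((P.map (W i)).withDensity (f i)) :=
    fun i => hlaw i ▸ pV i
  have key : P.map (fun ω i => V i ω) =
      (P.map fun ω i => W i ω).withDensity fun p => ∏ i, f i (p i) := by
    rw [(iIndepFun_iff_map_fun_eq_pi_map fun i => (hV i).aemeasurable).1 iV,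
      (iIndepFun_iff_map_fun_eq_pi_map fun i => (hW i).aemeasurable).1 iW, ← pi_withDensity _ _ hf]
    simp only [hlaw]
  have hfm : Measurable fun p : Fin n → unitInterval → ℝ => ∏ i, f i (p i) :=
    Finset.measurable_prod _ fun i _ => (hf i).comp (measurable_pi_apply i)
  have hVm : Measurable fun ω i => V i ω := measurable_pi_lambda _ hV
  have hWm : Measurable fun ω i => W i ω := measurable_pi_lambda _ hW
  calc _ = ∫⁻ p, G p ∂(P.map fun ω i => V i ω) := (lintegral_map hG hVm).symm
    _ = ∫⁻ p, G p * ∏ i, f i (p i) ∂(P.map fun ω i => W i ω) := by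
      rw [key, lintegral_withDensity_eq_lintegral_mul _ hfm hG]
      simp [mul_comm]
    _ = _ := by
      have hGf : Measurable fun p => G p * ∏ i, f i (p i) := hG.mul hfm
      rw [lintegral_map hGf hWm]
      refine lintegral_congr fun ω => ?_
      have h1 : ∀ i, W i ω 1 = σ i * β i (τ i) ω := fun i => by
        simp only [W]
        rw [min_eq_right (show τ i ≤ 1 from le_top)]
      simp only [f, h1]
      rfl

/-- The σ-algebra on `Ω` is a free parameter: taken to be the one generated by the raw paths, it
transfers independence to the paths as elements of the subtype. -/
lemma measurable_continuousPaths {Ω : Type*} {m : MeasurableSpace Ω}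
    {f : Ω → Fin n → unitInterval → ℝ} (hf : Measurable f) (hc : ∀ ω i, Continuous (f ω i)) :
    Measurable fun ω i => (⟨f ω i, hc ω i⟩ : CPath) :=
  measurable_pi_lambda _ fun i => ((measurable_pi_apply i).comp hf).subtype_mk

lemma measurable_signal_continuousPaths {Ω : Type*} {m : MeasurableSpace Ω} {X : Ω → 𝕏}
    {f : Ω → Fin n → unitInterval → ℝ} (hf : Measurable fun ω => ((X ω : ℝ), f ω))
    (hc : ∀ ω i, Continuous (f ω i)) :
    Measurable fun ω => (X ω, fun i => (⟨f ω i, hc ω i⟩ : CPath)) :=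
  (measurable_fst.comp hf).subtype_mk.prodMk
    (measurable_continuousPaths (measurable_snd.comp hf) hc)

lemma measurable_cadlagPath {Ω : Type*} {m : MeasurableSpace Ω}
    {f : Ω → unitInterval → Fin n → Bool} (hf : Measurable f) (hc : ∀ ω, IsCadlagPath (f ω)) :
    Measurable fun ω => (⟨f ω, hc ω⟩ : SwitchPath n) :=
  hf.subtype_mk

namespace IsModulatedSystem

/-- The switching process as a random path. -/
def switchPath (hS : IsModulatedSystem P X σ β J) (ω : Ω) : SwitchPath n :=
  ⟨fun t => J t ω, hS.cadlag_switch ω⟩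

/-- The Brownian bridges as random continuous paths. -/
def bridgePath (hS : IsModulatedSystem P X σ β J) (ω : Ω) (i : Fin n) : CPath :=
  ⟨fun s => β i s ω, (hS.bridge i).continuous_paths ω⟩

lemma measurable_switchPath (hS : IsModulatedSystem P X σ β J) : Measurable hS.switchPath :=
  (measurable_pi_lambda _ hS.measurable_switch).subtype_mk

lemma measurable_bridgePath (hS : IsModulatedSystem P X σ β J) : Measurable hS.bridgePath :=
  measurable_pi_lambda _ fun i => (measurable_pi_lambda _ (hS.bridge i).measurable).subtype_mk

lemma measurable_signal_coe (hS : IsModulatedSystem P X σ β J) : Measurable fun ω => (X ω : ℝ) :=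
  measurable_subtype_coe.comp hS.measurable_signal

lemma comap_bridgePath_le (hS : IsModulatedSystem P X σ β J) :
    MeasurableSpace.comap hS.bridgePath inferInstance ≤
      MeasurableSpace.comap (fun ω i (s : unitInterval) => β i s ω) inferInstance := by
  rw [← measurable_iff_comap_le]
  exact measurable_continuousPaths (comap_measurable _) fun ω i => (hS.bridge i).continuous_paths ω

lemma indepFun_signal_bridgePath (hS : IsModulatedSystem P X σ β J) :
    IndepFun X hS.bridgePath P :=
  indep_of_indep_of_le_right hS.indep_signal hS.comap_bridgePath_le

/-- Signal and bridges are recovered from `ξ`: almost surely `ξ₁` is the signal, and then `β⁽ⁱ⁾_s =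
(ξ⁽ⁱ⁾_s - s ξ₁) / σᵢ`. Without sources the switching process has only one value and is trivially
independent. -/
lemma indepFun_switchPath [IsProbabilityMeasure P] (hS : IsModulatedSystem P X σ β J) :
    IndepFun hS.switchPath (fun ω => (X ω, hS.bridgePath ω)) P := by
  have hraw : IndepFun (fun ω (s : unitInterval) => J s ω)
      (fun ω => ((X ω : ℝ), fun i (s : unitInterval) => β i s ω)) P := by
    rcases n with _ | n
    · have : (fun ω (s : unitInterval) => J s ω) = fun _ _ => Fin.elim0 := by
        ext ω s i
        exact i.elim0
      rw [this]
      exact indepFun_const_left _ _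
    · let g : (Fin (n + 1) → unitInterval → ℝ) → ℝ × (Fin (n + 1) → unitInterval → ℝ) := fun f =>
        (f 0 1, fun i s => (f i s - s * f 0 1) / σ i)
      have hg : Measurable g := by
        refine Measurable.prodMk (by fun_prop) (measurable_pi_lambda _ fun i =>
          measurable_pi_lambda _ fun s => by fun_prop)
      refine (hS.indep_switch.comp measurable_id hg).congr (ae_eq_refl _) ?_
      filter_upwards [(hS.bridge 0).ae_eq_zero (s := 1) (by simp)] with ω hω
      have h1 : infoProcess X σ β 0 1 ω = X ω := by simp [infoProcess, hω]
      simp only [Function.comp, g, h1]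
      simp only [infoProcess]
      congr 1
      ext i s
      have := (hS.sigma_pos i).ne'
      field_simp
      ring
  refine indep_of_indep_of_le_left (indep_of_indep_of_le_right hraw ?_) ?_
  · rw [← measurable_iff_comap_le]
    exact measurable_signal_continuousPaths (comap_measurable _)
      fun ω i => (hS.bridge i).continuous_paths ω
  · rw [← measurable_iff_comap_le]
    exact measurable_cadlagPath (comap_measurable _) hS.cadlag_switch

/-- The observations up to time `t`. -/
noncomputable def infoRecord (hS : IsModulatedSystem P X σ β J) (t : unitInterval) (ω : Ω) : ObsRecord n :=
  record t (hS.switchPath ω) fun i u => infoProcess X σ β i u ω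

/-- The observations up to time `t` in the absence of a signal. -/
noncomputable def noiseRecord (hS : IsModulatedSystem P X σ β J) (t : unitInterval) (ω : Ω) : ObsRecord n :=
  record t (hS.switchPath ω) fun i u => σ i * β i u ω

lemma measurable_infoRecord (hS : IsModulatedSystem P X σ β J) {t : unitInterval} (ht : t < 1) :
    Measurable (hS.infoRecord t) :=
  (measurable_record_affine σ ht).comp
    (hS.measurable_switchPath.prodMk (hS.measurable_signal_coe.prodMk hS.measurable_bridgePath))

lemma measurable_noiseRecord (hS : IsModulatedSystem P X σ β J) {t : unitInterval} (ht : t < 1) :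
    Measurable (hS.noiseRecord t) := by
  have := (measurable_record_affine σ ht).comp
    (hS.measurable_switchPath.prodMk ((measurable_const (a := (0 : ℝ))).prodMk hS.measurable_bridgePath))
  have hω : hS.noiseRecord t = (fun p : SwitchPath n × ℝ × (Fin n → CPath) =>
      record t p.1 fun i u => u * p.2.1 + σ i * (p.2.2 i).1 u) ∘
      fun ω => (hS.switchPath ω, 0, hS.bridgePath ω) := by
    ext1 ω
    simp [noiseRecord, bridgePath]
  rw [hω]
  exact this

end IsModulatedSystem

end ModulatedInformation

/-! ### Joint law of the signal and the record. -/

namespace ModulatedInformation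

variable {Ω : Type*} [MeasurableSpace Ω] {P : Measure Ω} {𝕏 : Set ℝ} {n : ℕ} {X : Ω → 𝕏}
  {σ : Fin n → ℝ} {β : Fin n → unitInterval → Ω → ℝ} {J : unitInterval → Ω → Fin n → Bool}

lemma measurable_ofReal_likelihood (σ : Fin n → ℝ) {t : unitInterval} (ht : t < 1) :
    Measurable fun p : 𝕏 × ObsRecord n => ENNReal.ofReal (likelihood σ t p.1 p.2) := by
  have h1 : Measurable fun p : 𝕏 × ObsRecord n => ((p.1 : ℝ), p.2) :=
    (measurable_subtype_coe.comp measurable_fst).prodMk measurable_snd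
  have h2 := (measurable_likelihood σ ht).comp h1
  exact h2.ennreal_ofReal

lemma lintegral_of_indepFun [IsProbabilityMeasure P] {S B : Type*} [MeasurableSpace S]
    [MeasurableSpace B] {j : Ω → S} {b : Ω → B} (hj : Measurable j) (hb : Measurable b)
    (h : IndepFun j b P) {F : S × B → ℝ≥0∞} (hF : Measurable F) :
    ∫⁻ ω, F (j ω, b ω) ∂P = ∫⁻ s, ∫⁻ ω, F (s, b ω) ∂P ∂(P.map j) := by
  have pb : IsProbabilityMeasure (P.map b) := Measure.isProbabilityMeasure_map hb.aemeasurable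
  rw [← lintegral_map hF (hj.prodMk hb),
    (indepFun_iff_map_prod_eq_prod_map_map hj.aemeasurable hb.aemeasurable).1 h,
    lintegral_prod _ hF.aemeasurable]
  exact lintegral_congr fun s => lintegral_map (hF.comp measurable_prodMk_left) hb

lemma lintegral_of_indepFun_prod [IsProbabilityMeasure P] {S A B : Type*} [MeasurableSpace S]
    [MeasurableSpace A] [MeasurableSpace B] {j : Ω → S} {x : Ω → A} {b : Ω → B}
    (hj : Measurable j) (hx : Measurable x) (hb : Measurable b)
    (h : IndepFun j (fun ω => (x ω, b ω)) P) (h' : IndepFun x b P)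
    {F : S × A × B → ℝ≥0∞} (hF : Measurable F) :
    ∫⁻ ω, F (j ω, x ω, b ω) ∂P =
      ∫⁻ a, ∫⁻ s, ∫⁻ ω, F (s, a, b ω) ∂P ∂(P.map j) ∂(P.map x) := by
  have px : IsProbabilityMeasure (P.map x) := Measure.isProbabilityMeasure_map hx.aemeasurable
  have pj : IsProbabilityMeasure (P.map j) := Measure.isProbabilityMeasure_map hj.aemeasurable
  rw [lintegral_of_indepFun hj (hx.prodMk hb) h hF]
  have e : ∀ s, ∫⁻ ω, F (s, x ω, b ω) ∂P = ∫⁻ a, ∫⁻ ω, F (s, a, b ω) ∂P ∂(P.map x) := fun s =>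
    lintegral_of_indepFun hx hb h' (hF.comp measurable_prodMk_left)
  simp only [e]
  refine lintegral_lintegral_swap (Measurable.aemeasurable ?_)
  exact Measurable.lintegral_prod_right' (f := fun q : (S × A) × Ω => F (q.1.1, q.1.2, b q.2))
    (hF.comp (by fun_prop))

namespace IsModulatedSystem

/-- The joint law of the signal and the observations has the density `likelihood` with respect to
the product of the law of the signal and the law of the pure noise. -/
theorem lintegral_signal_infoRecord [IsProbabilityMeasure P] (hS : IsModulatedSystem P X σ β J)
    {t : unitInterval} (ht : t < 1) {F : 𝕏 × ObsRecord n → ℝ≥0∞} (hF : Measurable F) :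
    ∫⁻ ω, F (X ω, hS.infoRecord t ω) ∂P =
      ∫⁻ x, ∫⁻ r, F (x, r) * ENNReal.ofReal (likelihood σ t x r) ∂(P.map (hS.noiseRecord t))
        ∂(P.map X) := by
  have hX := hS.measurable_signal
  have hb := hS.measurable_bridgePath
  have hj := hS.measurable_switchPath
  have hjb : IndepFun hS.switchPath hS.bridgePath P :=
    hS.indepFun_switchPath.comp (φ := id) (ψ := Prod.snd) measurable_id measurable_snd
  let R : SwitchPath n × ℝ × (Fin n → CPath) → ObsRecord n := fun p =>
    record t p.1 fun i u => u * p.2.1 + σ i * (p.2.2 i).1 u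
  have hR : Measurable R := measurable_record_affine σ ht
  have hA : Measurable fun p : SwitchPath n × 𝕏 × (Fin n → CPath) =>
      F (p.2.1, R (p.1, (p.2.1 : ℝ), p.2.2)) :=
    hF.comp ((measurable_fst.comp measurable_snd).prodMk (hR.comp (measurable_fst.prodMk
      ((measurable_subtype_coe.comp (measurable_fst.comp measurable_snd)).prodMk
        (measurable_snd.comp measurable_snd)))))
  have hw : Measurable fun p : 𝕏 × ObsRecord n => ENNReal.ofReal (likelihood σ t p.1 p.2) :=
    measurable_ofReal_likelihood σ ht
  have hinfo : ∀ ω, hS.infoRecord t ω = R (hS.switchPath ω, (X ω : ℝ), hS.bridgePath ω) :=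
    fun ω => rfl
  -- Signal outermost, bridges innermost: in the inner integral the signal and the stopping times
  -- are constants.
  have e1 := lintegral_of_indepFun_prod hj hX hb hS.indepFun_switchPath
    hS.indepFun_signal_bridgePath hA
  simp only [hinfo]
  rw [e1]
  refine lintegral_congr fun x => ?_
  have hC : Measurable fun p : SwitchPath n × (Fin n → CPath) =>
      F (x, R (p.1, 0, p.2)) * ENNReal.ofReal (likelihood σ t x (R (p.1, 0, p.2))) :=
    (hF.mul hw).comp (measurable_const.prodMk (hR.comp (measurable_fst.prodMk
      (measurable_const.prodMk measurable_snd))))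
  have hnoise : ∀ ω, hS.noiseRecord t ω = R (hS.switchPath ω, 0, hS.bridgePath ω) := fun ω => by
    simp [noiseRecord, R, bridgePath]
  have e2 : ∫⁻ r, F (x, r) * ENNReal.ofReal (likelihood σ t x r) ∂(P.map (hS.noiseRecord t)) =
      ∫⁻ ω, F (x, R (hS.switchPath ω, 0, hS.bridgePath ω)) *
        ENNReal.ofReal (likelihood σ t x (R (hS.switchPath ω, 0, hS.bridgePath ω))) ∂P := by
    have hFx : Measurable fun r => F (x, r) * ENNReal.ofReal (likelihood σ t x r) :=
      (hF.mul hw).comp measurable_prodMk_left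
    rw [lintegral_map hFx (hS.measurable_noiseRecord ht)]
    exact lintegral_congr fun ω => by rw [hnoise]
  rw [e2]
  refine Eq.trans (lintegral_congr fun j => ?_) (lintegral_of_indepFun hj hb hjb hC).symm
  have hj1 : ∀ i, j.last t i < 1 := fun i => (lastActive_le _ _).trans_lt ht
  have key := lintegral_shift_stopped hS.bridge hS.indep_bridges hS.sigma_pos hj1 x
    (G := fun f => F (x, (j, f))) (hF.comp (measurable_const.prodMk
      (measurable_const.prodMk measurable_id)))
  refine key.trans (lintegral_congr fun ω => ?_)
  simp only [R, record, likelihood, bridgePath]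
  rw [ENNReal.ofReal_prod_of_nonneg fun i _ => (h_pos _ _ _ _).le]
  simp only [mul_zero, zero_add]
  congr 1
  refine Finset.prod_congr rfl fun i _ => ?_
  rw [min_eq_right (show j.last t i ≤ 1 from le_top)]

end IsModulatedSystem

end ModulatedInformation

/-! ### Bayes' formula for a joint law with a density. -/

namespace ModulatedInformation

section Bayes

variable {Ω : Type*} [MeasurableSpace Ω] {P : Measure Ω} {𝒳 E : Type*} [MeasurableSpace 𝒳]
  [MeasurableSpace E] {X : Ω → 𝒳} {R : Ω → E} {Q : Measure E} {w : 𝒳 × E → ℝ≥0∞}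

/-- By Tonelli, the record restricted to `{X ∈ C}` has density `∫⁻ x in C, w (x, r)` with respect to
`Q`. -/
lemma setLIntegral_comp_evidence [IsProbabilityMeasure P] [IsProbabilityMeasure Q]
    (hX : Measurable X) (hR : Measurable R) (hw : Measurable w)
    (hlaw : ∀ F : 𝒳 × E → ℝ≥0∞, Measurable F →
      ∫⁻ ω, F (X ω, R ω) ∂P = ∫⁻ x, ∫⁻ r, F (x, r) * w (x, r) ∂Q ∂(P.map X))
    {g : E → ℝ≥0∞} (hg : Measurable g) {C : Set 𝒳} (hC : MeasurableSet C) {D : Set E}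
    (hD : MeasurableSet D) :
    ∫⁻ ω in R ⁻¹' D ∩ X ⁻¹' C, g (R ω) ∂P =
      ∫⁻ r in D, g r * ∫⁻ x in C, w (x, r) ∂(P.map X) ∂Q := by
  have pX : IsProbabilityMeasure (P.map X) := Measure.isProbabilityMeasure_map hX.aemeasurable
  have hwr : ∀ r, Measurable fun x => w (x, r) := fun r => hw.comp measurable_prodMk_right
  have hF : Measurable ((C ×ˢ D).indicator fun p : 𝒳 × E => g p.2) :=
    (hg.comp measurable_snd).indicator (hC.prod hD)
  rw [← lintegral_indicator ((hR hD).inter (hX hC))]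
  have e : ∀ ω, (R ⁻¹' D ∩ X ⁻¹' C).indicator (fun ω => g (R ω)) ω =
      ((C ×ˢ D).indicator fun p : 𝒳 × E => g p.2) (X ω, R ω) := fun ω => by
    rw [Set.prod_eq, inter_comm]
    rfl
  simp only [e]
  rw [hlaw _ hF, lintegral_lintegral_swap (hF.mul hw).aemeasurable, ← lintegral_indicator hD]
  refine lintegral_congr fun r => ?_
  by_cases hr : r ∈ D
  · rw [indicator_of_mem hr, ← lintegral_const_mul _ (hwr r), ← lintegral_indicator hC]
    refine lintegral_congr fun x => ?_
    by_cases hx : x ∈ C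
    · rw [indicator_of_mem (mk_mem_prod hx hr), indicator_of_mem hx]
    · rw [indicator_of_notMem (fun h => hx h.1), indicator_of_notMem hx, zero_mul]
  · rw [indicator_of_notMem hr, lintegral_eq_zero_iff]
    · exact Eventually.of_forall fun x => by
        simp only [Pi.zero_apply]
        rw [indicator_of_notMem (fun h => hr h.2), zero_mul]
    · exact (hF.mul hw).comp measurable_prodMk_right

/-- The evidence is the density of a probability law, so it has integral `1` under `Q`. -/
lemma ae_evidence_lt_top [IsProbabilityMeasure P] [IsProbabilityMeasure Q] (hX : Measurable X)
    (hR : Measurable R) (hw : Measurable w)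
    (hlaw : ∀ F : 𝒳 × E → ℝ≥0∞, Measurable F →
      ∫⁻ ω, F (X ω, R ω) ∂P = ∫⁻ x, ∫⁻ r, F (x, r) * w (x, r) ∂Q ∂(P.map X)) :
    ∀ᵐ r ∂Q, ∫⁻ x, w (x, r) ∂(P.map X) < ∞ := by
  have pX : IsProbabilityMeasure (P.map X) := Measure.isProbabilityMeasure_map hX.aemeasurable
  refine ae_lt_top hw.lintegral_prod_left' ?_
  have := setLIntegral_comp_evidence hX hR hw hlaw (g := fun _ => 1) measurable_const
    MeasurableSet.univ MeasurableSet.univ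
  simp only [preimage_univ, inter_univ, one_mul, lintegral_const, measure_univ,
    Measure.restrict_univ] at this
  rw [← this]
  exact ENNReal.one_ne_top

/-- The law of `R` is absolutely continuous with respect to `Q`, so the `Q`-null set of infinite
evidence is not charged by it. -/
lemma ae_evidence_ne_top [IsProbabilityMeasure P] [IsProbabilityMeasure Q] (hX : Measurable X)
    (hR : Measurable R) (hw : Measurable w)
    (hlaw : ∀ F : 𝒳 × E → ℝ≥0∞, Measurable F →
      ∫⁻ ω, F (X ω, R ω) ∂P = ∫⁻ x, ∫⁻ r, F (x, r) * w (x, r) ∂Q ∂(P.map X)) :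
    ∀ᵐ ω ∂P, ∫⁻ x, w (x, R ω) ∂(P.map X) ≠ ∞ := by
  have pX : IsProbabilityMeasure (P.map X) := Measure.isProbabilityMeasure_map hX.aemeasurable
  have hN : Measurable fun r => ∫⁻ x, w (x, r) ∂(P.map X) := hw.lintegral_prod_left'
  have hs : MeasurableSet {r | ∫⁻ x, w (x, r) ∂(P.map X) = ∞} := hN (measurableSet_singleton _)
  have h3 := setLIntegral_comp_evidence hX hR hw hlaw (g := fun _ => 1) measurable_const
    MeasurableSet.univ hs
  have hQ : Q {r | ∫⁻ x, w (x, r) ∂(P.map X) = ∞} = 0 :=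
    measure_eq_zero_iff_ae_notMem.2
      ((ae_evidence_lt_top hX hR hw hlaw).mono fun r hr => by simpa using hr.ne)
  rw [setLIntegral_measure_zero _ _ hQ, setLIntegral_one, preimage_univ, inter_univ] at h3
  exact measure_eq_zero_iff_ae_notMem.1 h3

/-- Bayes' formula, for a signal that is known to be in `B`. -/
lemma bayes_inter [IsProbabilityMeasure P] [IsProbabilityMeasure Q] (hX : Measurable X)
    (hR : Measurable R) (hw : Measurable w)
    (hlaw : ∀ F : 𝒳 × E → ℝ≥0∞, Measurable F →
      ∫⁻ ω, F (X ω, R ω) ∂P = ∫⁻ x, ∫⁻ r, F (x, r) * w (x, r) ∂Q ∂(P.map X))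
    {A B : Set 𝒳} (hA : MeasurableSet A) (hB : MeasurableSet B) {D : Set E} (hD : MeasurableSet D) :
    P (R ⁻¹' D ∩ X ⁻¹' (A ∩ B)) = ∫⁻ ω in R ⁻¹' D ∩ X ⁻¹' B,
      (∫⁻ x in A ∩ B, w (x, R ω) ∂(P.map X)) / (∫⁻ x in B, w (x, R ω) ∂(P.map X)) ∂P := by
  have pX : IsProbabilityMeasure (P.map X) := Measure.isProbabilityMeasure_map hX.aemeasurable
  have hN : ∀ C : Set 𝒳, Measurable fun r => ∫⁻ x in C, w (x, r) ∂(P.map X) :=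
    fun C => hw.lintegral_prod_left'
  have h1 := setLIntegral_comp_evidence hX hR hw hlaw ((hN (A ∩ B)).div (hN B)) hB hD
  have h2 := setLIntegral_comp_evidence hX hR hw hlaw (g := fun _ => 1) measurable_const
    (hA.inter hB) hD
  rw [setLIntegral_one] at h2
  refine h2.trans (Eq.trans ?_ h1.symm)
  refine lintegral_congr_ae (ae_restrict_of_ae ?_)
  filter_upwards [ae_evidence_lt_top hX hR hw hlaw] with r hr
  -- Cancelling in `ℝ≥0∞` is legitimate: a zero denominator forces a zero numerator since `A ∩ B ⊆
  -- B`, and the denominator is finite almost everywhere.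
  rw [one_mul, Pi.div_apply, ENNReal.div_mul_cancel' (fun h0 => ?_) fun h => ?_]
  · exact le_antisymm ((lintegral_mono_set inter_subset_right).trans h0.le) bot_le
  · exact absurd h ((setLIntegral_le_lintegral B _).trans_lt hr).ne

end Bayes

/-! ### A criterion for conditional laws, and the posterior given the record. -/

lemma measurable_normalized {Ω 𝒳 : Type*} {m : MeasurableSpace Ω} [MeasurableSpace 𝒳]
    (ν : Measure 𝒳) [IsProbabilityMeasure ν] {f : Ω → 𝒳 → ℝ≥0∞}
    (hf : Measurable (Function.uncurry f)) (A : Set 𝒳) :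
    Measurable fun ω => (∫⁻ x, f ω x ∂ν)⁻¹ * ∫⁻ x in A, f ω x ∂ν :=
  (hf.lintegral_prod_right').inv.mul hf.lintegral_prod_right'

/-- The identity `hset` is inherited by smaller σ-algebras, so for these only a measurable version
of `κ` remains to be found. A version up to null sets is all that is asked, because facts such as
`ξ₀ = 0` hold only almost surely. -/
theorem isCondLaw_of_setLIntegral {Ω : Type*} {m : MeasurableSpace Ω}
    [mΩ : MeasurableSpace Ω] {P : Measure Ω} [IsProbabilityMeasure P] {𝕏 : Set ℝ} {X : Ω → 𝕏}
    (hX : Measurable X) {κ : Ω → Measure 𝕏} (hm : m ≤ mΩ)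
    (hκ : ∀ᵐ ω ∂P, IsProbabilityMeasure (κ ω))
    (hmeas : ∀ A : Set 𝕏, MeasurableSet A →
      ∃ g : Ω → ℝ≥0∞, Measurable[m] g ∧ (fun ω => κ ω A) =ᵐ[P] g)
    (hset : ∀ A : Set 𝕏, MeasurableSet A → ∀ D, MeasurableSet[m] D →
      ∫⁻ ω in D, κ ω A ∂P = P (D ∩ X ⁻¹' A)) :
    IsCondLaw P X m κ := by
  refine ⟨hm, hκ, fun A hA => ?_⟩
  obtain ⟨g, hg, hκg⟩ := hmeas A hA
  have hκm : AEMeasurable (fun ω => κ ω A) P := ⟨g, hg.mono hm le_rfl, hκg⟩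
  have hle : ∀ᵐ ω ∂P, κ ω A ≤ 1 := hκ.mono fun ω h => prob_le_one
  have hint : Integrable (fun ω => (κ ω).real A) P :=
    integrable_toReal_of_lintegral_ne_top hκm
      (ne_top_of_le_ne_top (by simp) (lintegral_mono_ae (g := fun _ => 1) hle))
  have hXA : MeasurableSet (X ⁻¹' A) := hX hA
  symm
  refine ae_eq_condExp_of_forall_setIntegral_eq hm ?_ (fun D _ _ => hint.integrableOn)
    (fun D hD _ => ?_) ?_
  · exact (integrable_const (1 : ℝ)).indicator hXA
  · rw [setIntegral_indicator hXA]
    simp only [Measure.real]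
    rw [integral_toReal hκm.restrict
      (ae_restrict_of_ae (hle.mono fun ω h => h.trans_lt ENNReal.one_lt_top)), hset A hA D hD]
    simp [Measure.real]
  · exact ⟨fun ω => (g ω).toReal, hg.ennreal_toReal.stronglyMeasurable,
      hκg.mono fun ω h => by simp only [Measure.real, h]⟩

lemma effVol_sq {n : ℕ} {σ : Fin n → ℝ} (hσ : ∀ i, 0 < σ i) {j : Fin n → Bool} (hj : active j ≠ ∅) :
    effVol σ j ^ 2 = (∑ i ∈ active j, (σ i ^ 2)⁻¹)⁻¹ ∧ effVol σ j ≠ 0 := by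
  have hpos : 0 < ∑ i ∈ active j, (σ i ^ 2)⁻¹ :=
    Finset.sum_pos (fun i _ => inv_pos.2 (pow_pos (hσ i) 2)) (Finset.nonempty_iff_ne_empty.2 hj)
  rw [effVol, if_neg hj]
  refine ⟨?_, (Real.rpow_pos_of_pos hpos _).ne'⟩
  rw [← Real.rpow_natCast, ← Real.rpow_mul hpos.le]
  norm_num
  exact Real.rpow_neg_one _

/-- The active sources act like one source with the effective parameters. -/
lemma h_effInfo {Ω : Type*} {𝕏 : Set ℝ} {n : ℕ} {X : Ω → 𝕏} {σ : Fin n → ℝ}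
    {β : Fin n → unitInterval → Ω → ℝ} {J : unitInterval → Ω → Fin n → Bool} (hσ : ∀ i, 0 < σ i) (t : unitInterval) (ω : Ω) (x : ℝ) :
    h x (effInfo X σ β J t ω) t (effVol σ (J t ω)) =
      ∏ i ∈ active (J t ω), h x (infoProcess X σ β i t ω) t (σ i) := by
  by_cases hj : active (J t ω) = ∅
  · rw [h, if_pos (by rw [effVol, if_pos hj]), hj, Finset.prod_empty]
  · obtain ⟨h2, h0⟩ := effVol_sq hσ hj
    rw [h, if_neg h0]
    have : ∀ i, h x (infoProcess X σ β i t ω) t (σ i) = Real.exp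
        ((x * infoProcess X σ β i t ω - t * x ^ 2 / 2) / (σ i ^ 2 * (1 - t))) := fun i => by
      rw [h, if_neg (hσ i).ne']
    simp only [this]
    rw [← Real.exp_sum, effInfo, h2]
    congr 1
    have hpos : ∑ i ∈ active (J t ω), (σ i ^ 2)⁻¹ ≠ 0 := fun h' => by
      rw [h', inv_zero] at h2
      exact h0 (pow_eq_zero_iff (two_ne_zero) |>.1 h2)
    -- `S` is the total precision; dividing by `σ̂² = S⁻¹` cancels the factor `S⁻¹` in the effective
    -- information.
    set S := ∑ i ∈ active (J t ω), (σ i ^ 2)⁻¹ with hS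
    rw [div_mul_eq_div_div, div_inv_eq_mul, sub_mul, ← mul_assoc, mul_assoc _ S⁻¹]
    have e : x * (S⁻¹ * ∑ i ∈ active (J t ω), (σ i ^ 2)⁻¹ * infoProcess X σ β i t ω) * S =
        x * ∑ i ∈ active (J t ω), (σ i ^ 2)⁻¹ * infoProcess X σ β i t ω := by
      field_simp
    simp only [← mul_assoc] at e ⊢
    rw [e, hS, Finset.mul_sum, Finset.mul_sum, ← Finset.sum_sub_distrib, Finset.sum_div]
    refine Finset.sum_congr rfl fun i _ => ?_
    rw [div_mul_eq_div_div]
    congr 1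
    rw [div_eq_mul_inv _ (σ i ^ 2)]
    ring

variable {Ω : Type*} [MeasurableSpace Ω] {P : Measure Ω} {𝕏 : Set ℝ} {n : ℕ} {X : Ω → 𝕏}
  {σ : Fin n → ℝ} {β : Fin n → unitInterval → Ω → ℝ} {J : unitInterval → Ω → Fin n → Bool}

namespace IsModulatedSystem

lemma infoRecord_last (hS : IsModulatedSystem P X σ β J) (t : unitInterval) (ω : Ω) (i : Fin n) :
    (hS.infoRecord t ω).2 i 1 =
      infoProcess X σ β i (lastActive (fun u => J u ω i) t) ω := by
  simp only [infoRecord, record]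
  rw [min_eq_right (show (hS.switchPath ω).last t i ≤ 1 from le_top)]
  rfl

/-- An active source is stopped at `t` itself, so the product over all sources splits into the
effective and the complementary factor. -/
lemma weight_eq (hS : IsModulatedSystem P X σ β J) (t : unitInterval) (ω : Ω) (x : 𝕏) :
    weight X σ β J t ω x = likelihood σ t x (hS.infoRecord t ω) := by
  rw [weight, h_effInfo hS.sigma_pos, compInfo, likelihood,
    ← Finset.prod_mul_prod_compl (active (J t ω))]
  congr 1
  · refine Finset.prod_congr rfl fun i hi => ?_
    rw [infoRecord_last]
    have hi' : J t ω i = true := by simpa [active] using hi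
    have h1 : lastActive (fun u => J u ω i) t = t := lastActive_eq_self hi'
    have h2 : (hS.infoRecord t ω).1.last t i = t := h1
    rw [h1, h2]
  · refine Finset.prod_congr rfl fun i _ => ?_
    rw [infoRecord_last]
    rfl

lemma weight_pos (hS : IsModulatedSystem P X σ β J) (t : unitInterval) (ω : Ω) (x : 𝕏) :
    0 < weight X σ β J t ω x := by
  rw [hS.weight_eq]
  exact likelihood_pos _ _ _ _

lemma isProbabilityMeasure_signal [IsProbabilityMeasure P] (hS : IsModulatedSystem P X σ β J) :
    IsProbabilityMeasure (P.map X) :=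
  Measure.isProbabilityMeasure_map hS.measurable_signal.aemeasurable

lemma measurable_weight (hS : IsModulatedSystem P X σ β J) {t : unitInterval} (ht : t < 1) (ω : Ω) :
    Measurable fun x => ENNReal.ofReal (weight X σ β J t ω x) := by
  have h1 := (measurable_ofReal_likelihood (𝕏 := 𝕏) σ ht).comp
    (measurable_prodMk_right (y := hS.infoRecord t ω))
  have h2 : (fun x => ENNReal.ofReal (weight X σ β J t ω x)) =
      (fun p : 𝕏 × ObsRecord n => ENNReal.ofReal (likelihood σ t p.1 p.2)) ∘
        fun x => (x, hS.infoRecord t ω) := by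
    ext1 x
    rw [hS.weight_eq]
    rfl
  rw [h2]
  exact h1

/-- The weight is positive everywhere; unlike finiteness of the normaliser, this needs no
exceptional null set. -/
lemma setLIntegral_weight_ne_zero (hS : IsModulatedSystem P X σ β J) {t : unitInterval} (ht : t < 1)
    (ω : Ω) {B : Set 𝕏} (hB : P.map X B ≠ 0) :
    ∫⁻ x in B, ENNReal.ofReal (weight X σ β J t ω x) ∂(P.map X) ≠ 0 := by
  have hm := hS.measurable_weight ht ω
  have hsupp : Function.support (fun x => ENNReal.ofReal (weight X σ β J t ω x)) = univ :=
    eq_univ_of_forall fun x => (ENNReal.ofReal_pos.2 (hS.weight_pos t ω x)).ne'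
  refine ((setLIntegral_pos_iff hm).2 ?_).ne'
  rw [hsupp, univ_inter]
  exact pos_iff_ne_zero.2 hB

theorem ae_normalizer [IsProbabilityMeasure P] (hS : IsModulatedSystem P X σ β J)
    {t : unitInterval} (ht : t < 1) :
    ∀ᵐ ω ∂P, normalizer P X σ β J t ω ≠ 0 ∧ normalizer P X σ β J t ω ≠ ∞ := by
  have pX := hS.isProbabilityMeasure_signal
  have pQ : IsProbabilityMeasure (P.map (hS.noiseRecord t)) :=
    Measure.isProbabilityMeasure_map (hS.measurable_noiseRecord ht).aemeasurable
  filter_upwards [ae_evidence_ne_top hS.measurable_signal (hS.measurable_infoRecord ht)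
    (measurable_ofReal_likelihood σ ht) fun F hF => hS.lintegral_signal_infoRecord ht hF] with ω hω
  refine ⟨?_, ?_⟩
  · have := hS.setLIntegral_weight_ne_zero ht ω (B := univ) (by simp)
    rwa [setLIntegral_univ] at this
  · simpa only [normalizer, hS.weight_eq] using hω

lemma posterior_apply (t : unitInterval) (ω : Ω) {A : Set 𝕏} (hA : MeasurableSet A) :
    posterior P X σ β J t ω A = (normalizer P X σ β J t ω)⁻¹ *
      ∫⁻ x in A, ENNReal.ofReal (weight X σ β J t ω x) ∂(P.map X) := by
  rw [posterior, Measure.smul_apply, withDensity_apply _ hA, smul_eq_mul]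

lemma ae_isProbabilityMeasure_posterior [IsProbabilityMeasure P]
    (hS : IsModulatedSystem P X σ β J) {t : unitInterval} (ht : t < 1) :
    ∀ᵐ ω ∂P, IsProbabilityMeasure (posterior P X σ β J t ω) := by
  filter_upwards [hS.ae_normalizer ht] with ω hω
  refine ⟨?_⟩
  rw [posterior_apply t ω MeasurableSet.univ, setLIntegral_univ]
  exact ENNReal.inv_mul_cancel hω.1 hω.2

/-- `B = univ` yields the posterior; bounded `B` serves the limit `s ↓ t` for the augmented
filtration. -/
lemma measure_inter_preimage [IsProbabilityMeasure P] (hS : IsModulatedSystem P X σ β J)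
    {t : unitInterval} (ht : t < 1) {A B : Set 𝕏} (hA : MeasurableSet A) (hB : MeasurableSet B)
    {D : Set Ω} (hD : MeasurableSet[MeasurableSpace.comap (hS.infoRecord t) inferInstance] D) :
    P (D ∩ X ⁻¹' (A ∩ B)) = ∫⁻ ω in D ∩ X ⁻¹' B,
      (∫⁻ x in A ∩ B, ENNReal.ofReal (weight X σ β J t ω x) ∂(P.map X)) /
        (∫⁻ x in B, ENNReal.ofReal (weight X σ β J t ω x) ∂(P.map X)) ∂P := by
  obtain ⟨D, hD, rfl⟩ := hD
  have pQ : IsProbabilityMeasure (P.map (hS.noiseRecord t)) :=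
    Measure.isProbabilityMeasure_map (hS.measurable_noiseRecord ht).aemeasurable
  have := bayes_inter hS.measurable_signal (hS.measurable_infoRecord ht)
    (measurable_ofReal_likelihood σ ht) (fun F hF => hS.lintegral_signal_infoRecord ht hF) hA hB hD
  simpa only [hS.weight_eq] using this

lemma setLIntegral_posterior [IsProbabilityMeasure P] (hS : IsModulatedSystem P X σ β J)
    {t : unitInterval} (ht : t < 1) {A : Set 𝕏} (hA : MeasurableSet A)
    {D : Set Ω} (hD : MeasurableSet[MeasurableSpace.comap (hS.infoRecord t) inferInstance] D) :
    ∫⁻ ω in D, posterior P X σ β J t ω A ∂P = P (D ∩ X ⁻¹' A) := by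
  have := hS.measure_inter_preimage ht hA MeasurableSet.univ hD
  simp only [inter_univ, preimage_univ, setLIntegral_univ] at this
  rw [this]
  refine lintegral_congr fun ω => ?_
  rw [posterior_apply t ω hA, mul_comm, ← div_eq_mul_inv]
  rfl

end IsModulatedSystem

end ModulatedInformation

/-! ### Measurable versions of the posterior for the smaller σ-algebras. -/

namespace ModulatedInformation

/-- The last observation of the signal `y` along the first `k` times of a dense sequence. -/
noncomputable def lastObs (t : unitInterval) (a : unitInterval → Bool) (y : unitInterval → ℝ) :
    ℕ → unitInterval × ℝ
  -- The right reading for a source that has never been active, since `ξ₀ = 0` almost surely.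
  | 0 => (0, 0)
  | k + 1 => if a (denseTime t k) = true ∧ (lastObs t a y k).1 ≤ denseTime t k then
      (denseTime t k, y (denseTime t k)) else lastObs t a y k

lemma lastObs_snd (t : unitInterval) (a : unitInterval → Bool) {y : unitInterval → ℝ}
    (hy : y 0 = 0) (k : ℕ) : (lastObs t a y k).2 = y (lastObs t a y k).1 := by
  induction k with
  | zero => simp [lastObs, hy]
  | succ k ih =>
    rw [lastObs]
    split_ifs
    · rfl
    · exact ih

lemma monotone_lastObs (t : unitInterval) (a : unitInterval → Bool) (y : unitInterval → ℝ) :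
    Monotone fun k => (lastObs t a y k).1 := by
  refine monotone_nat_of_le_succ fun k => ?_
  rw [lastObs]
  split_ifs with hk
  · exact hk.2
  · exact le_rfl

lemma lastObs_le (t : unitInterval) (a : unitInterval → Bool) (y : unitInterval → ℝ) (k : ℕ) :
    (lastObs t a y k).1 ≤ lastActive a t := by
  induction k with
  | zero => exact bot_le
  | succ k ih =>
    rw [lastObs]
    split_ifs with hk
    · exact le_lastActive (denseTime_le t k) hk.1
    · exact ih

lemma le_lastObs {t : unitInterval} {a : unitInterval → Bool} (y : unitInterval → ℝ) {k : ℕ}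
    (hk : a (denseTime t k) = true) : denseTime t k ≤ (lastObs t a y (k + 1)).1 := by
  rw [lastObs]
  split_ifs with h
  · exact le_rfl
  · exact (not_le.1 fun h' => h ⟨hk, h'⟩).le

lemma tendsto_lastObs_fst {t : unitInterval} (ht : t < 1) {a : unitInterval → Bool}
    (ha : ∀ s, ContinuousWithinAt a (Ici s) s) (y : unitInterval → ℝ) :
    Tendsto (fun k => (lastObs t a y k).1) atTop (𝓝 (lastActive a t)) := by
  refine tendsto_atTop_isLUB (monotone_lastObs t a y) ⟨?_, fun b hb => ?_⟩
  · rintro _ ⟨k, rfl⟩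
    exact lastObs_le t a y k
  · rw [lastActive_eq_iSup ht ha]
    refine iSup_le fun k => ?_
    split_ifs with hk
    · exact (le_lastObs y hk).trans (hb ⟨k + 1, rfl⟩)
    · exact bot_le

/-- A source that switches off at its last active time is not observed at that time. Continuity of
the path recovers the value there as a limit of observed ones. -/
lemma tendsto_lastObs_snd {t : unitInterval} (ht : t < 1) {a : unitInterval → Bool}
    (ha : ∀ s, ContinuousWithinAt a (Ici s) s) {y : unitInterval → ℝ} (hy : Continuous y)
    (hy0 : y 0 = 0) :
    Tendsto (fun k => (lastObs t a y k).2) atTop (𝓝 (y (lastActive a t))) := by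
  simp only [lastObs_snd t a hy0]
  exact (hy.tendsto _).comp (tendsto_lastObs_fst ht ha y)

lemma measurable_lastObs {Ω : Type*} {m : MeasurableSpace Ω} {t : unitInterval}
    {a : Ω → unitInterval → Bool} {y : Ω → unitInterval → ℝ}
    (ha : ∀ u ≤ t, Measurable fun ω => a ω u)
    (hy : ∀ u ≤ t, Measurable fun ω => if a ω u = true then y ω u else 0) (k : ℕ) :
    Measurable fun ω => lastObs t (a ω) (y ω) k := by
  induction k with
  | zero => exact measurable_const
  | succ k ih =>
    have hak := ha _ (denseTime_le t k)
    -- The recursion reads `y` only while the source is active, so `y` may be replaced by its masked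
    -- version, the one that is observed.
    have e : (fun ω => lastObs t (a ω) (y ω) (k + 1)) = fun ω =>
        if a ω (denseTime t k) = true ∧ (lastObs t (a ω) (y ω) k).1 ≤ denseTime t k then
          (denseTime t k, if a ω (denseTime t k) = true then y ω (denseTime t k) else 0)
        else lastObs t (a ω) (y ω) k := by
      ext1 ω
      rw [lastObs]
      split_ifs with h1 h2
      · rfl
      · exact absurd h1.1 h2
      · rfl
    rw [e]
    exact Measurable.ite ((hak (measurableSet_singleton true)).inter
      (ih.fst measurableSet_Iic))
      (measurable_const.prodMk (hy _ (denseTime_le t k))) ih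

lemma continuous_h (y t s : ℝ) : Continuous fun x => h x y t s := by
  unfold h
  split_ifs
  · exact continuous_const
  · fun_prop

/-- The σ-algebra of evaluations controls `c` at one `x` at a time; continuity in `x` gives the
joint measurability that integration over `x` requires. -/
lemma measurable_effective_ratio {Ω : Type*} {m : MeasurableSpace Ω} {𝕏 : Set ℝ} (ν : Measure 𝕏)
    [IsProbabilityMeasure ν] (t : ℝ) {e v : Ω → ℝ} {c : Ω → 𝕏 → ℝ} (he : Measurable e)
    (hv : Measurable v) (hc : ∀ x, Measurable fun ω => c ω x) (hcont : ∀ ω, Continuous (c ω))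
    (A : Set 𝕏) :
    Measurable fun ω => (∫⁻ x, ENNReal.ofReal (h x (e ω) t (v ω) * c ω x) ∂ν)⁻¹ *
      ∫⁻ x in A, ENNReal.ofReal (h x (e ω) t (v ω) * c ω x) ∂ν := by
  refine measurable_normalized ν (f := fun ω x => ENNReal.ofReal (h x (e ω) t (v ω) * c ω x)) ?_ A
  have hcu : Measurable (Function.uncurry fun (x : 𝕏) ω => c ω x) :=
    measurable_uncurry_of_continuous_of_measurable (u := fun (x : 𝕏) ω => c ω x) hcont hc
  have hcu' : Measurable fun p : Ω × 𝕏 => c p.1 p.2 := hcu.comp measurable_swap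
  have hh : Measurable fun p : Ω × 𝕏 => h p.2 (e p.1) t (v p.1) :=
    measurable_h_comp (measurable_subtype_coe.comp measurable_snd) (he.comp measurable_fst)
      measurable_const (hv.comp measurable_fst)
  exact (hh.mul hcu').ennreal_ofReal

lemma measurable_likelihood_ratio {Ω : Type*} {m : MeasurableSpace Ω} {𝕏 : Set ℝ} (ν : Measure 𝕏)
    [IsProbabilityMeasure ν] {n : ℕ} (σ : Fin n → ℝ) {τ : Fin n → Ω → unitInterval}
    {V : Fin n → Ω → ℝ} (hτ : ∀ i, Measurable (τ i)) (hV : ∀ i, Measurable (V i)) (A : Set 𝕏) :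
    Measurable fun ω => (∫⁻ x : 𝕏, ENNReal.ofReal (∏ i, h x (V i ω) (τ i ω) (σ i)) ∂ν)⁻¹ *
      ∫⁻ x in A, ENNReal.ofReal (∏ i, h x (V i ω) (τ i ω) (σ i)) ∂ν := by
  refine measurable_normalized ν
    (f := fun ω (x : 𝕏) => ENNReal.ofReal (∏ i, h x (V i ω) (τ i ω) (σ i))) ?_ A
  have hh : Measurable fun p : Ω × 𝕏 => ∏ i, h p.2 (V i p.1) (τ i p.1) (σ i) :=
    Finset.measurable_prod _ fun i _ => measurable_h_comp
      (measurable_subtype_coe.comp measurable_snd) ((hV i).comp measurable_fst)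
      (measurable_subtype_coe.comp ((hτ i).comp measurable_fst)) measurable_const
  exact hh.ennreal_ofReal

lemma switchMatrix_mulVec {n : ℕ} (j : Fin n → Bool) (y : Fin n → ℝ) :
    switchMatrix j *ᵥ y = fun i => if j i = true then y i else 0 := by
  ext i
  rw [switchMatrix, Matrix.mulVec_diagonal]
  split_ifs <;> simp

lemma measurable_switch_observed {Ω : Type*} {𝕏 : Set ℝ} {n : ℕ} (X : Ω → 𝕏)
    (σ : Fin n → ℝ) (β : Fin n → unitInterval → Ω → ℝ) (J : unitInterval → Ω → Fin n → Bool)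
    {u t : unitInterval} (hu : u ≤ t) (i : Fin n) :
    Measurable[observed X σ β J t] fun ω => J u ω i := by
  have h1 : Measurable[observed X σ β J t] (J u) := measurable_iff_comap_le.2
    ((le_iSup₂ (f := fun u (_ : u ≤ t) => MeasurableSpace.comap (J u) inferInstance) u hu).trans
      (le_sup_right.trans le_sup_left))
  exact (measurable_pi_apply i).comp h1

lemma measurable_info_observed {Ω : Type*} {𝕏 : Set ℝ} {n : ℕ} (X : Ω → 𝕏)
    (σ : Fin n → ℝ) (β : Fin n → unitInterval → Ω → ℝ) (J : unitInterval → Ω → Fin n → Bool)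
    {u t : unitInterval} (hu : u ≤ t) (i : Fin n) :
    Measurable[observed X σ β J t] fun ω =>
      if J u ω i = true then infoProcess X σ β i u ω else 0 := by
  have h1 : Measurable[observed X σ β J t]
      fun ω => switchMatrix (J u ω) *ᵥ fun i => infoProcess X σ β i u ω := measurable_iff_comap_le.2
    ((le_iSup₂ (f := fun u (_ : u ≤ t) => MeasurableSpace.comap
      (fun ω => switchMatrix (J u ω) *ᵥ fun i => infoProcess X σ β i u ω) inferInstance) u hu).trans
      (le_sup_left.trans le_sup_left))
  have h2 := (measurable_pi_apply i).comp h1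
  simp only [switchMatrix_mulVec] at h2
  exact h2

lemma continuous_compInfo {Ω : Type*} {𝕏 : Set ℝ} {n : ℕ} (X : Ω → 𝕏) (σ : Fin n → ℝ)
    (β : Fin n → unitInterval → Ω → ℝ) (J : unitInterval → Ω → Fin n → Bool) (t : unitInterval)
    (ω : Ω) : Continuous (compInfo X σ β J t ω) :=
  continuous_finsetProd _ fun _ _ => (continuous_h _ _ _).comp continuous_subtype_val

lemma setLIntegral_cond {Ω : Type*} [MeasurableSpace Ω] (P : Measure Ω) {S D : Set Ω}
    (hD : MeasurableSet D) (f : Ω → ℝ≥0∞) :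
    ∫⁻ ω in D, f ω ∂P[|S] = (P S)⁻¹ * ∫⁻ ω in D ∩ S, f ω ∂P := by
  rw [ProbabilityTheory.cond, Measure.restrict_smul, lintegral_smul_measure, Measure.restrict_restrict hD, smul_eq_mul]

lemma measurable_effInfo_effCompInfo {Ω : Type*} {𝕏 : Set ℝ} {n : ℕ} (X : Ω → 𝕏) (σ : Fin n → ℝ)
    (β : Fin n → unitInterval → Ω → ℝ) (J : unitInterval → Ω → Fin n → Bool) (t : unitInterval) :
    Measurable[effCompInfo X σ β J t] (effInfo X σ β J t) :=
  measurable_iff_comap_le.2 le_sup_left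

lemma measurable_compInfo_effCompInfo {Ω : Type*} {𝕏 : Set ℝ} {n : ℕ} (X : Ω → 𝕏) (σ : Fin n → ℝ)
    (β : Fin n → unitInterval → Ω → ℝ) (J : unitInterval → Ω → Fin n → Bool) (t : unitInterval)
    (x : 𝕏) : Measurable[effCompInfo X σ β J t] fun ω => compInfo X σ β J t ω x := by
  have h1 : Measurable[effCompInfo X σ β J t] (compInfo X σ β J t) :=
    measurable_iff_comap_le.2 le_sup_right
  exact (measurable_pi_apply x).comp h1

variable {Ω : Type*} [MeasurableSpace Ω] {P : Measure Ω} {𝕏 : Set ℝ} {n : ℕ} {X : Ω → 𝕏}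
  {σ : Fin n → ℝ} {β : Fin n → unitInterval → Ω → ℝ} {J : unitInterval → Ω → Fin n → Bool}

namespace IsModulatedSystem

lemma continuous_infoProcess (hS : IsModulatedSystem P X σ β J) (i : Fin n) (ω : Ω) :
    Continuous fun u => infoProcess X σ β i u ω := by
  have := (hS.bridge i).continuous_paths ω
  unfold infoProcess
  fun_prop

lemma comap_infoRecord_le (hS : IsModulatedSystem P X σ β J) {t : unitInterval} (ht : t < 1) :
    MeasurableSpace.comap (hS.infoRecord t) inferInstance ≤ ‹MeasurableSpace Ω› :=
  (hS.measurable_infoRecord ht).comap_le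

lemma comap_comp_infoRecord_le (hS : IsModulatedSystem P X σ β J) {t : unitInterval}
    {B : Type*} [MeasurableSpace B] {φ : ObsRecord n → B} (hφ : Measurable φ) {f : Ω → B}
    (hf : ∀ ω, f ω = φ (hS.infoRecord t ω)) :
    MeasurableSpace.comap f inferInstance ≤
      MeasurableSpace.comap (hS.infoRecord t) inferInstance := by
  have : f = φ ∘ hS.infoRecord t := funext hf
  rw [this, ← measurable_iff_comap_le]
  exact hφ.comp (comap_measurable _)

lemma measurable_record_activity (u : unitInterval) (i : Fin n) :
    Measurable fun r : ObsRecord n => r.1.1 u i :=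
  (measurable_activity u i).comp measurable_fst

lemma measurable_record_path (u : unitInterval) (i : Fin n) :
    Measurable fun r : ObsRecord n => r.2 i u :=
  (measurable_pi_apply u).comp ((measurable_pi_apply i).comp measurable_snd)

/-- If a source is active at `u ≤ t`, then `u` does not exceed its last active time and stopping
does not alter the value at `u`. For `t < 1` the term with the signal is constant. -/
lemma observed_le (hS : IsModulatedSystem P X σ β J) {t : unitInterval} (ht : t < 1) :
    observed X σ β J t ≤ MeasurableSpace.comap (hS.infoRecord t) inferInstance := by
  refine sup_le (sup_le (iSup₂_le fun u hu => ?_) (iSup₂_le fun u hu => ?_)) ?_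
  · refine hS.comap_comp_infoRecord_le
      (φ := fun r i => if r.1.1 u i = true then r.2 i u else 0) ?_ fun ω => ?_
    · exact measurable_pi_lambda _ fun i => Measurable.ite
        (measurable_record_activity u i (measurableSet_singleton true))
        (measurable_record_path u i) measurable_const
    · rw [switchMatrix_mulVec]
      ext i
      by_cases hj : J u ω i = true
      · have h1 : min u (lastActive (fun s => J s ω i) t) = u :=
          min_eq_left (le_lastActive (a := fun s => J s ω i) hu hj)
        have h2 : (hS.infoRecord t ω).2 i u =
          infoProcess X σ β i (min u (lastActive (fun s => J s ω i) t)) ω := rfl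
        rw [if_pos hj, h2, h1, if_pos (show (hS.infoRecord t ω).1.1 u i = true from hj)]
      · rw [if_neg hj, if_neg (show ¬ (hS.infoRecord t ω).1.1 u i = true from hj)]
  · exact hS.comap_comp_infoRecord_le (φ := fun r => r.1.1 u)
      (measurable_pi_lambda _ fun i => measurable_record_activity u i) fun ω => rfl
  · simp only [if_neg ht.ne]
    rw [MeasurableSpace.comap_const]
    exact bot_le

lemma comap_effVol_le (hS : IsModulatedSystem P X σ β J) (t : unitInterval) :
    MeasurableSpace.comap (fun ω => effVol σ (J t ω)) inferInstance ≤
      MeasurableSpace.comap (hS.infoRecord t) inferInstance :=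
  hS.comap_comp_infoRecord_le (φ := fun r => effVol σ (r.1.1 t))
    ((measurable_of_finite (effVol σ)).comp
      (measurable_pi_lambda _ fun i => measurable_record_activity t i)) fun _ => rfl

lemma effCompInfo_le (hS : IsModulatedSystem P X σ β J) {t : unitInterval} (ht : t < 1) :
    effCompInfo X σ β J t ≤ MeasurableSpace.comap (hS.infoRecord t) inferInstance := by
  refine sup_le ?_ ?_
  · refine hS.comap_comp_infoRecord_le (φ := fun r => effVol σ (r.1.1 t) ^ 2 *
      ∑ i, if r.1.1 t i = true then (σ i ^ 2)⁻¹ * r.2 i 1 else 0) ?_ fun ω => ?_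
    · refine Measurable.mul (((measurable_of_finite (effVol σ)).comp
        (measurable_pi_lambda _ fun i => measurable_record_activity t i)).pow_const 2) ?_
      exact Finset.measurable_sum _ fun i _ => Measurable.ite
        (measurable_record_activity t i (measurableSet_singleton true))
        ((measurable_record_path 1 i).const_mul _) measurable_const
    · rw [effInfo, active, Finset.sum_filter]
      congr 1
      refine Finset.sum_congr rfl fun i _ => ?_
      by_cases hj : J t ω i = true
      · rw [if_pos hj, if_pos (show (hS.infoRecord t ω).1.1 t i = true from hj), infoRecord_last,
          lastActive_eq_self hj]
      · rw [if_neg hj, if_neg (show ¬ (hS.infoRecord t ω).1.1 t i = true from hj)]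
  · refine hS.comap_comp_infoRecord_le (φ := fun r (x : 𝕏) =>
      ∏ i, if r.1.1 t i = true then 1 else h x (r.2 i 1) (r.1.last t i) (σ i)) ?_ fun ω => ?_
    · refine measurable_pi_lambda _ fun x => Finset.measurable_prod _ fun i _ => Measurable.ite
        (measurable_record_activity t i (measurableSet_singleton true)) measurable_const ?_
      exact measurable_h_comp measurable_const (measurable_record_path 1 i)
        (measurable_subtype_coe.comp ((measurable_last ht i).comp measurable_fst)) measurable_const
    · ext x
      rw [compInfo, active, Finset.compl_filter, Finset.prod_filter]
      refine Finset.prod_congr rfl fun i _ => ?_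
      rw [infoRecord_last]
      by_cases hj : J t ω i = true
      · rw [if_neg (not_not.2 hj), if_pos (show (hS.infoRecord t ω).1.1 t i = true from hj)]
      · rw [if_pos hj, if_neg (show ¬ (hS.infoRecord t ω).1.1 t i = true from hj)]
        rfl

/-- The posterior is a function of the effective and complementary information wherever these
determine the volatility parameter. -/
lemma exists_measurable_posterior_of_effCompInfo_le {Ω : Type*} {m : MeasurableSpace Ω}
    [MeasurableSpace Ω] {P : Measure Ω} [IsProbabilityMeasure P] {X : Ω → 𝕏}
    {β : Fin n → unitInterval → Ω → ℝ} {J : unitInterval → Ω → Fin n → Bool}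
    (hS : IsModulatedSystem P X σ β J) (t : unitInterval)
    (hm : effCompInfo X σ β J t ≤ m) {v : Ω → ℝ} (hv : Measurable[m] v) {P' : Measure Ω}
    (hev : (fun ω => effVol σ (J t ω)) =ᵐ[P'] v) {A : Set 𝕏} (hA : MeasurableSet A) :
    ∃ g : Ω → ℝ≥0∞, Measurable[m] g ∧ (fun ω => posterior P X σ β J t ω A) =ᵐ[P'] g := by
  have pX := hS.isProbabilityMeasure_signal
  refine ⟨_, measurable_effective_ratio (P.map X) t
    ((measurable_effInfo_effCompInfo X σ β J t).mono hm le_rfl) hv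
    (fun x => (measurable_compInfo_effCompInfo X σ β J t x).mono hm le_rfl)
    (continuous_compInfo X σ β J t) A, ?_⟩
  filter_upwards [hev] with ω hω
  rw [posterior_apply t ω hA, normalizer]
  simp only [weight, hω]

lemma exists_measurable_posterior_observed [IsProbabilityMeasure P]
    (hS : IsModulatedSystem P X σ β J) {t : unitInterval} (ht : t < 1)
    {A : Set 𝕏} (hA : MeasurableSet A) :
    ∃ g : Ω → ℝ≥0∞, Measurable[observed X σ β J t] g ∧
      (fun ω => posterior P X σ β J t ω A) =ᵐ[P] g := by
  have pX := hS.isProbabilityMeasure_signal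
  let O : Fin n → Ω → ℕ → unitInterval × ℝ := fun i ω k =>
    lastObs t (fun u => J u ω i) (fun u => infoProcess X σ β i u ω) k
  have hO : ∀ i k, Measurable[observed X σ β J t] fun ω => O i ω k := fun i k =>
    measurable_lastObs (fun u hu => measurable_switch_observed X σ β J hu i)
      (fun u hu => measurable_info_observed X σ β J hu i) k
  -- A `limsup` is defined and measurable without exception; it is the limit off the null set where
  -- some bridge does not start at `0`.
  have hV : ∀ i, Measurable[observed X σ β J t] fun ω => limsup (fun k => (O i ω k).2) atTop :=
    fun i => Measurable.limsup fun k => (hO i k).snd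
  have hR : ∀ ω i s, ContinuousWithinAt (fun u => J u ω i) (Ici s) s := fun ω i =>
    (hS.cadlag_switch ω).continuousWithinAt_apply i
  have hτ : ∀ i, Measurable[observed X σ β J t] fun ω => lastActive (fun u => J u ω i) t :=
    fun i => measurable_lastActive ht
      (fun u hu => measurable_switch_observed X σ β J hu i) fun ω => hR ω i
  refine ⟨_, measurable_likelihood_ratio (P.map X) σ hτ hV A, ?_⟩
  have h0 : ∀ᵐ ω ∂P, ∀ i, β i 0 ω = 0 :=
    ae_all_iff.2 fun i => (hS.bridge i).ae_eq_zero (by simp)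
  filter_upwards [h0] with ω hω
  have hlim : ∀ i, limsup (fun k => (O i ω k).2) atTop =
      infoProcess X σ β i (lastActive (fun u => J u ω i) t) ω := fun i =>
    (tendsto_lastObs_snd ht (hR ω i) (hS.continuous_infoProcess i ω)
      (by simp [infoProcess, hω i])).limsup_eq
  rw [posterior_apply t ω hA, normalizer]
  simp only [hS.weight_eq, likelihood, infoRecord_last, hlim]
  rfl

theorem isCondLaw_observed [IsProbabilityMeasure P] (hS : IsModulatedSystem P X σ β J)
    {t : unitInterval} (ht : t < 1) :
    IsCondLaw P X (observed X σ β J t) (posterior P X σ β J t) :=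
  isCondLaw_of_setLIntegral hS.measurable_signal
    ((hS.observed_le ht).trans (hS.comap_infoRecord_le ht))
    (hS.ae_isProbabilityMeasure_posterior ht)
    (fun _ hA => hS.exists_measurable_posterior_observed ht hA)
    fun _ hA _ hD => hS.setLIntegral_posterior ht hA (hS.observed_le ht _ hD)

theorem isCondLaw_effCompInfo_sup [IsProbabilityMeasure P] (hS : IsModulatedSystem P X σ β J)
    {t : unitInterval} (ht : t < 1) :
    IsCondLaw P X
      (effCompInfo X σ β J t ⊔ MeasurableSpace.comap (fun ω => effVol σ (J t ω)) inferInstance)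
      (posterior P X σ β J t) := by
  have hle := sup_le (hS.effCompInfo_le ht) (hS.comap_effVol_le t)
  exact isCondLaw_of_setLIntegral hS.measurable_signal (hle.trans (hS.comap_infoRecord_le ht))
    (hS.ae_isProbabilityMeasure_posterior ht)
    (fun _ hA => hS.exists_measurable_posterior_of_effCompInfo_le t le_sup_left
      (measurable_iff_comap_le.2 le_sup_right) (ae_eq_refl _) hA)
    fun _ hA _ hD => hS.setLIntegral_posterior ht hA (hle _ hD)

theorem isCondLaw_effCompInfo [IsProbabilityMeasure P] (hS : IsModulatedSystem P X σ β J)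
    {t : unitInterval} (ht : t < 1) {v : Ω → ℝ} (hv : Measurable[effCompInfo X σ β J t] v)
    (hev : (fun ω => effVol σ (J t ω)) =ᵐ[P] v) :
    IsCondLaw P X (effCompInfo X σ β J t) (posterior P X σ β J t) :=
  isCondLaw_of_setLIntegral hS.measurable_signal
    ((hS.effCompInfo_le ht).trans (hS.comap_infoRecord_le ht))
    (hS.ae_isProbabilityMeasure_posterior ht)
    (fun _ hA => hS.exists_measurable_posterior_of_effCompInfo_le t le_rfl hv hev hA)
    fun _ hA _ hD => hS.setLIntegral_posterior ht hA (hS.effCompInfo_le ht _ hD)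

/-- Under the conditioned measure the effective volatility is almost surely constant, hence has a
measurable version. The event `J t = k` belongs to the σ-algebra of the record, so Bayes' formula
applies to its intersection with `D`. -/
theorem isCondLaw_cond_effCompInfo [IsProbabilityMeasure P] (hS : IsModulatedSystem P X σ β J)
    {t : unitInterval} (ht : t < 1) {k : Fin n → Bool} (hk : P (J t ⁻¹' {k}) ≠ 0) :
    IsCondLaw (P[|J t ⁻¹' {k}]) X (effCompInfo X σ β J t) (posterior P X σ β J t) := by
  have pk : IsProbabilityMeasure P[|J t ⁻¹' {k}] := cond_isProbabilityMeasure hk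
  have hle := hS.effCompInfo_le ht
  have hJ : MeasurableSet (J t ⁻¹' {k}) := hS.measurable_switch t (measurableSet_singleton k)
  have hJ' : MeasurableSet[MeasurableSpace.comap (hS.infoRecord t) inferInstance]
      (J t ⁻¹' {k}) :=
    ⟨{r | r.1.1 t = k}, (measurable_pi_lambda _ fun i => measurable_record_activity t i)
      (measurableSet_singleton k), rfl⟩
  refine isCondLaw_of_setLIntegral hS.measurable_signal (hle.trans (hS.comap_infoRecord_le ht))
    (cond_absolutelyContinuous.ae_le (hS.ae_isProbabilityMeasure_posterior ht))
    (fun A hA => hS.exists_measurable_posterior_of_effCompInfo_le t le_rfl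
      (v := fun _ => effVol σ k) measurable_const ?_ hA) fun A hA D hD => ?_
  · filter_upwards [ae_cond_mem hJ] with ω hω
    rw [show J t ω = k from hω]
  · have hD' := (hle.trans (hS.comap_infoRecord_le ht)) _ hD
    have hDH := hle _ hD
    rw [setLIntegral_cond P hD', hS.setLIntegral_posterior ht hA
      (@MeasurableSet.inter _ (MeasurableSpace.comap (hS.infoRecord t) inferInstance) _ _ hDH hJ'),
      cond_apply hJ]
    congr 2
    ext ω
    simp only [mem_inter_iff]
    tauto

end IsModulatedSystem

end ModulatedInformation

/-! ### Right limits and the augmented filtration. -/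

namespace ModulatedInformation

lemma nullEvents_le {Ω : Type*} [mΩ : MeasurableSpace Ω] (P : Measure Ω) : nullEvents P ≤ mΩ :=
  MeasurableSpace.generateFrom_le fun _ hN => hN.1

lemma exists_ae_eq_of_measurableSet_sup_nullEvents {Ω : Type*} {F : MeasurableSpace Ω}
    [MeasurableSpace Ω] {P : Measure Ω} {D : Set Ω} (hD : MeasurableSet[F ⊔ nullEvents P] D) :
    ∃ D', MeasurableSet[F] D' ∧ D =ᵐ[P] D' := by
  have hle : F ⊔ nullEvents P ≤ eventuallyMeasurableSpace F (ae P) := by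
    refine sup_le le_eventuallyMeasurableSpace (MeasurableSpace.generateFrom_le fun N hN => ?_)
    exact ⟨∅, @MeasurableSet.empty _ F, ae_eq_empty.2 hN.2⟩
  exact hle _ hD

/-- If the source is active at `t`, the value at `s > t` lies between `t` and `s`. If not, the
source stays inactive just after `t` and the value does not change. -/
lemma tendsto_lastActive {a : unitInterval → Bool} {t : unitInterval}
    (ha : ContinuousWithinAt a (Ici t) t) :
    Tendsto (lastActive a) (𝓝[>] t) (𝓝 (lastActive a t)) := by
  have hgt : ∀ᶠ s in 𝓝[>] t, t < s := eventually_mem_nhdsWithin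
  by_cases hat : a t = true
  · rw [lastActive_eq_self hat]
    refine tendsto_of_tendsto_of_tendsto_of_le_of_le' tendsto_const_nhds
      (tendsto_nhdsWithin_of_tendsto_nhds tendsto_id) ?_ ?_
    · exact hgt.mono fun s hs => le_lastActive hs.le hat
    · exact Eventually.of_forall fun s => lastActive_le a s
  · refine tendsto_const_nhds.congr' ?_
    have h1 : ∀ᶠ s in 𝓝[≥] t, a s = a t :=
      ha.eventually_mem ((isOpen_discrete {a t}).mem_nhds rfl)
    rcases (show t ≤ 1 from le_top).eq_or_lt with rfl | ht1
    · filter_upwards [hgt] with s hs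
      exact absurd hs (not_lt.2 le_top)
    obtain ⟨v, hv, hv'⟩ := (mem_nhdsGE_iff_exists_Ico_subset' ht1).1 h1
    filter_upwards [Ioo_mem_nhdsGT hv] with s hs
    refine le_antisymm (sSup_le fun u hu => le_lastActive (hu.1.trans hs.1.le) hu.2)
      (sSup_le fun u hu => ?_)
    refine le_lastActive (not_lt.1 fun htu => ?_) hu.2
    have : a u = a t := hv' ⟨htu.le, hu.1.trans_lt hs.2⟩
    exact hat (this ▸ hu.2)

lemma tendsto_h {α : Type*} {l : Filter α} {y s : α → ℝ} {y₀ s₀ : ℝ} (x : ℝ) {σ : ℝ} (hσ : 0 < σ)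
    (hs₀ : s₀ < 1) (hy : Tendsto y l (𝓝 y₀)) (hs : Tendsto s l (𝓝 s₀)) :
    Tendsto (fun a => h x (y a) (s a) σ) l (𝓝 (h x y₀ s₀ σ)) := by
  simp only [h, if_neg hσ.ne']
  refine (Real.continuous_exp.tendsto _).comp (Tendsto.div ?_ ?_ ?_)
  · exact (hy.const_mul x).sub ((hs.mul_const _).div_const 2)
  · exact (tendsto_const_nhds.sub hs).const_mul _
  · have : 1 - s₀ ≠ 0 := by linarith
    positivity

/-- Dropping the nonpositive term `-s x² / 2` leaves a bound uniform over `|x| ≤ K`. -/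
lemma h_le {x K : ℝ} (hx : |x| ≤ K) (y : ℝ) {s : ℝ} (hs0 : 0 ≤ s) (hs1 : s < 1) {σ : ℝ}
    (hσ : 0 < σ) : h x y s σ ≤ Real.exp (K * |y| / (σ ^ 2 * (1 - s))) := by
  rw [h, if_neg hσ.ne']
  have h1 : 0 < 1 - s := by linarith
  have h2 : x * y ≤ K * |y| := by
    calc x * y ≤ |x * y| := le_abs_self _
      _ = |x| * |y| := abs_mul _ _
      _ ≤ K * |y| := by gcongr
  have h3 : 0 ≤ s * x ^ 2 / 2 := by positivity
  gcongr
  linarith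

lemma observed_mono {Ω : Type*} {𝕏 : Set ℝ} {n : ℕ} (X : Ω → 𝕏) (σ : Fin n → ℝ) (β : Fin n → unitInterval → Ω → ℝ)
    (J : unitInterval → Ω → Fin n → Bool) {s t : unitInterval} (hs : s < 1) (hst : s ≤ t) :
    observed X σ β J s ≤ observed X σ β J t := by
  refine sup_le (le_trans (sup_le_sup ?_ ?_) le_sup_left) ?_
  · exact biSup_mono fun u hu => hu.trans hst
  · exact biSup_mono fun u hu => hu.trans hst
  · simp only [if_neg hs.ne]
    rw [MeasurableSpace.comap_const]
    exact bot_le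

variable {Ω : Type*} [MeasurableSpace Ω] {P : Measure Ω} {𝕏 : Set ℝ} {n : ℕ} {X : Ω → 𝕏}
  {σ : Fin n → ℝ} {β : Fin n → unitInterval → Ω → ℝ} {J : unitInterval → Ω → Fin n → Bool}

namespace IsModulatedSystem

lemma measurable_infoProcess (hS : IsModulatedSystem P X σ β J) (i : Fin n) (u : unitInterval) :
    Measurable (infoProcess X σ β i u) :=
  (hS.measurable_signal_coe.const_mul _).add (((hS.bridge i).measurable u).const_mul _)

lemma observed_le_ambient (hS : IsModulatedSystem P X σ β J) (t : unitInterval) :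
    observed X σ β J t ≤ ‹MeasurableSpace Ω› := by
  refine sup_le (sup_le (iSup₂_le fun u _ => ?_) (iSup₂_le fun u _ => ?_)) ?_
  · refine Measurable.comap_le ?_
    simp only [switchMatrix_mulVec]
    exact measurable_pi_lambda _ fun i => Measurable.ite
      (((measurable_pi_apply i).comp (hS.measurable_switch u)) (measurableSet_singleton true))
      (hS.measurable_infoProcess i u) measurable_const
  · exact (hS.measurable_switch u).comap_le
  · refine Measurable.comap_le ?_
    split_ifs
    · exact hS.measurable_signal_coe
    · exact measurable_const

lemma measurable_setLIntegral_weight [IsProbabilityMeasure P] (hS : IsModulatedSystem P X σ β J)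
    {t : unitInterval} (ht : t < 1) (C : Set 𝕏) :
    Measurable fun ω => ∫⁻ x in C, ENNReal.ofReal (weight X σ β J t ω x) ∂(P.map X) := by
  have pX := hS.isProbabilityMeasure_signal
  have h1 : Measurable fun r : ObsRecord n =>
      ∫⁻ x in C, ENNReal.ofReal (likelihood σ t x r) ∂(P.map X) :=
    (measurable_ofReal_likelihood (𝕏 := 𝕏) σ ht).lintegral_prod_left'
  have h2 := h1.comp (hS.measurable_infoRecord ht)
  simp only [hS.weight_eq]
  exact h2

lemma tendsto_weight (hS : IsModulatedSystem P X σ β J) {t : unitInterval} (ht : t < 1) (ω : Ω)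
    (x : 𝕏) : Tendsto (fun s => weight X σ β J s ω x) (𝓝[>] t) (𝓝 (weight X σ β J t ω x)) := by
  simp only [hS.weight_eq, likelihood, infoRecord_last]
  refine tendsto_finsetProd _ fun i _ => ?_
  have hl := tendsto_lastActive ((hS.cadlag_switch ω).continuousWithinAt_apply i t)
  exact tendsto_h _ (hS.sigma_pos i) ((lastActive_le (fun u => J u ω i) t).trans_lt ht)
    (((hS.continuous_infoProcess i ω).tendsto _).comp hl)
    ((continuous_subtype_val.tendsto _).comp hl)

lemma eventually_weight_le (hS : IsModulatedSystem P X σ β J) {t : unitInterval} (ht : t < 1)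
    (ω : Ω) (K : ℝ) :
    ∃ M : ℝ, ∀ᶠ s in 𝓝[>] t, ∀ x : 𝕏, |(x : ℝ)| ≤ K → weight X σ β J s ω x ≤ M := by
  let b : Fin n → unitInterval → ℝ := fun i u =>
    Real.exp (K * |(infoProcess X σ β i u ω)| / (σ i ^ 2 * (1 - u)))
  have hb : ∀ i, Tendsto (fun s => b i (lastActive (fun u => J u ω i) s)) (𝓝[>] t)
      (𝓝 (b i (lastActive (fun u => J u ω i) t))) := fun i => by
    have hl := tendsto_lastActive ((hS.cadlag_switch ω).continuousWithinAt_apply i t)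
    have h1 : ((lastActive (fun u => J u ω i) t : unitInterval) : ℝ) < 1 :=
      (lastActive_le (fun u => J u ω i) t).trans_lt ht
    refine (Real.continuous_exp.tendsto _).comp (Tendsto.div ?_ ?_ ?_)
    · exact (((hS.continuous_infoProcess i ω).tendsto _).comp hl).abs.const_mul K
    · exact (tendsto_const_nhds.sub ((continuous_subtype_val.tendsto _).comp hl)).const_mul _
    · have h2 := (hS.sigma_pos i).ne'
      have h3 : 1 - ((lastActive (fun u => J u ω i) t : unitInterval) : ℝ) ≠ 0 := by linarith
      positivity
  have hprod := tendsto_finsetProd Finset.univ fun i _ => hb i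
  -- The product of the bounds converges as `s ↓ t`, so its limit plus `1` dominates it eventually.
  refine ⟨∏ i, b i (lastActive (fun u => J u ω i) t) + 1, ?_⟩
  filter_upwards [hprod.eventually_le_const (lt_add_one _), Ioo_mem_nhdsGT ht] with s hs hs1 x hx
  refine le_trans ?_ hs
  rw [hS.weight_eq, likelihood]
  refine Finset.prod_le_prod (fun i _ => (h_pos _ _ _ _).le) fun i _ => ?_
  rw [infoRecord_last]
  exact h_le hx _ (lastActive (fun u => J u ω i) s).2.1
    ((lastActive_le (fun u => J u ω i) s).trans_lt hs1.2) (hS.sigma_pos i)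

lemma tendsto_setLIntegral_weight [IsProbabilityMeasure P] (hS : IsModulatedSystem P X σ β J)
    {t : unitInterval} (ht : t < 1) (ω : Ω) {K : ℝ} {C : Set 𝕏} (hC : MeasurableSet C)
    (hCK : ∀ x ∈ C, |(x : ℝ)| ≤ K) :
    Tendsto (fun s => ∫⁻ x in C, ENNReal.ofReal (weight X σ β J s ω x) ∂(P.map X)) (𝓝[>] t)
      (𝓝 (∫⁻ x in C, ENNReal.ofReal (weight X σ β J t ω x) ∂(P.map X))) := by
  have pX := hS.isProbabilityMeasure_signal
  obtain ⟨M, hM⟩ := hS.eventually_weight_le ht ω K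
  refine tendsto_lintegral_filter_of_dominated_convergence (fun _ => ENNReal.ofReal M) ?_ ?_ ?_ ?_
  · filter_upwards [Ioo_mem_nhdsGT ht] with s hs
    exact hS.measurable_weight hs.2 ω
  · filter_upwards [hM] with s hs
    filter_upwards [ae_restrict_mem hC] with x hx
    exact ENNReal.ofReal_le_ofReal (hs x (hCK x hx))
  · rw [lintegral_const]
    exact ENNReal.mul_ne_top ENNReal.ofReal_ne_top (measure_ne_top _ _)
  · exact ae_of_all _ fun x => (ENNReal.continuous_ofReal.tendsto _).comp (hS.tendsto_weight ht ω x)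

lemma setLIntegral_weight_ne_top_of_bounded [IsProbabilityMeasure P]
    (hS : IsModulatedSystem P X σ β J) {t : unitInterval} (ht : t < 1) (ω : Ω) {K : ℝ} {C : Set 𝕏}
    (hCK : ∀ x ∈ C, |(x : ℝ)| ≤ K) :
    ∫⁻ x in C, ENNReal.ofReal (weight X σ β J t ω x) ∂(P.map X) ≠ ∞ := by
  have pX := hS.isProbabilityMeasure_signal
  have : (𝓝[>] t).NeBot := nhdsGT_neBot_of_exists_gt ⟨1, ht⟩
  obtain ⟨M, hM⟩ := hS.eventually_weight_le ht ω K
  have hb : ∀ x ∈ C, ENNReal.ofReal (weight X σ β J t ω x) ≤ ENNReal.ofReal M := fun x hx =>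
    ENNReal.ofReal_le_ofReal (le_of_tendsto (hS.tendsto_weight ht ω x)
      (hM.mono fun s hs => hs x (hCK x hx)))
  refine ne_top_of_le_ne_top ?_ (setLIntegral_mono measurable_const hb)
  rw [setLIntegral_const]
  exact ENNReal.mul_ne_top ENNReal.ofReal_ne_top (measure_ne_top _ _)

lemma setLIntegral_weight_div_le_one (t : unitInterval) (ω : Ω) (A B : Set 𝕏) :
    (∫⁻ x in A ∩ B, ENNReal.ofReal (weight X σ β J t ω x) ∂(P.map X)) /
      (∫⁻ x in B, ENNReal.ofReal (weight X σ β J t ω x) ∂(P.map X)) ≤ 1 :=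
  ENNReal.div_le_of_le_mul (by rw [one_mul]; exact lintegral_mono_set inter_subset_right)

/-- Bayes' formula for the augmented filtration and a signal that is known to be in a bounded
set. -/
lemma measure_inter_preimage_usualAugmentation [IsProbabilityMeasure P]
    (hS : IsModulatedSystem P X σ β J) {t : unitInterval} (ht : t < 1) {A B : Set 𝕏}
    (hA : MeasurableSet A) (hB : MeasurableSet B) {K : ℝ} (hBK : ∀ x ∈ B, |(x : ℝ)| ≤ K)
    (hB0 : P.map X B ≠ 0) {D : Set Ω}
    (hD : MeasurableSet[usualAugmentation P (observed X σ β J) t] D) :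
    P (D ∩ X ⁻¹' (A ∩ B)) = ∫⁻ ω in D ∩ X ⁻¹' B,
      (∫⁻ x in A ∩ B, ENNReal.ofReal (weight X σ β J t ω x) ∂(P.map X)) /
        (∫⁻ x in B, ENNReal.ofReal (weight X σ β J t ω x) ∂(P.map X)) ∂P := by
  have : (𝓝[>] t).NeBot := nhdsGT_neBot_of_exists_gt ⟨1, ht⟩
  have hlim : Tendsto (fun s => ∫⁻ ω in D ∩ X ⁻¹' B,
      (∫⁻ x in A ∩ B, ENNReal.ofReal (weight X σ β J s ω x) ∂(P.map X)) /
        (∫⁻ x in B, ENNReal.ofReal (weight X σ β J s ω x) ∂(P.map X)) ∂P) (𝓝[>] t)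
      (𝓝 (∫⁻ ω in D ∩ X ⁻¹' B,
      (∫⁻ x in A ∩ B, ENNReal.ofReal (weight X σ β J t ω x) ∂(P.map X)) /
        (∫⁻ x in B, ENNReal.ofReal (weight X σ β J t ω x) ∂(P.map X)) ∂P)) := by
    refine tendsto_lintegral_filter_of_dominated_convergence (fun _ => 1) ?_ ?_ ?_ ?_
    · filter_upwards [Ioo_mem_nhdsGT ht] with s hs
      exact (hS.measurable_setLIntegral_weight hs.2 _).div (hS.measurable_setLIntegral_weight hs.2 _)
    · exact Eventually.of_forall fun s => ae_of_all _ fun ω => setLIntegral_weight_div_le_one s ω A B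
    · rw [lintegral_one]
      exact measure_ne_top _ _
    · refine ae_of_all _ fun ω => ?_
      have hABK : ∀ x ∈ A ∩ B, |(x : ℝ)| ≤ K := fun x hx => hBK x hx.2
      exact ENNReal.Tendsto.div (hS.tendsto_setLIntegral_weight ht ω (hA.inter hB) hABK)
        (Or.inr (hS.setLIntegral_weight_ne_zero ht ω hB0))
        (hS.tendsto_setLIntegral_weight ht ω hB hBK)
        (Or.inr (hS.setLIntegral_weight_ne_top_of_bounded ht ω hABK))
  refine tendsto_nhds_unique (tendsto_const_nhds.congr' ?_) hlim
  -- `D` agrees almost everywhere with an event observed by time `s`, for every `s > t`. Bayes'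
  -- formula at `s` therefore holds for `D`, with a left side that does not depend on `s`.
  filter_upwards [Ioo_mem_nhdsGT ht] with s hs
  have hle : usualAugmentation P (observed X σ β J) t ≤ observed X σ β J s ⊔ nullEvents P :=
    inf_le_right.trans (iInf₂_le s hs.1)
  obtain ⟨D', hD', hDD'⟩ := exists_ae_eq_of_measurableSet_sup_nullEvents (hle _ hD)
  have key := hS.measure_inter_preimage hs.2 hA hB (hS.observed_le hs.2 _ hD')
  have hPD : P (D ∩ X ⁻¹' (A ∩ B)) = P (D' ∩ X ⁻¹' (A ∩ B)) :=
    measure_congr (hDD'.inter (ae_eq_refl _))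
  rw [hPD, key]
  exact setLIntegral_congr (hDD'.symm.inter (ae_eq_refl _))

lemma setLIntegral_posterior_usualAugmentation [IsProbabilityMeasure P]
    (hS : IsModulatedSystem P X σ β J) {t : unitInterval} (ht : t < 1) {A : Set 𝕏}
    (hA : MeasurableSet A) {D : Set Ω}
    (hD : MeasurableSet[usualAugmentation P (observed X σ β J) t] D) :
    ∫⁻ ω in D, posterior P X σ β J t ω A ∂P = P (D ∩ X ⁻¹' A) := by
  have pX := hS.isProbabilityMeasure_signal
  -- Bayes' formula is available on `X ⁻¹' B k`; as `k → ∞` its ratios, bounded by `1`, converge to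
  -- the posterior.
  let B : ℕ → Set 𝕏 := fun k => {x | |(x : ℝ)| ≤ k}
  have hBm : ∀ k, MeasurableSet (B k) := fun k =>
    measurableSet_le measurable_subtype_coe.abs measurable_const
  have hBmono : Monotone B := fun k l hkl x hx =>
    (show |(x : ℝ)| ≤ k from hx).trans (Nat.cast_le.2 hkl)
  have hBev : ∀ x : 𝕏, ∀ᶠ k in atTop, x ∈ B k := fun x => by
    obtain ⟨k, hk⟩ := exists_nat_ge |(x : ℝ)|
    filter_upwards [eventually_ge_atTop k] with l hl
    exact hBmono hl hk
  have hBU : ⋃ k, B k = univ := eq_univ_of_forall fun x => mem_iUnion.2 (hBev x).exists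
  have hmeas : ∀ (μ : Measure 𝕏) (C : Set 𝕏),
      Tendsto (fun k => μ (C ∩ B k)) atTop (𝓝 (μ C)) := fun μ C => by
    have := tendsto_measure_iUnion_atTop (μ := μ) (s := fun k => C ∩ B k)
      fun k l hkl => inter_subset_inter_right C (hBmono hkl)
    rwa [← inter_iUnion, hBU, inter_univ] at this
  have hB0 : ∀ᶠ k in atTop, P.map X (B k) ≠ 0 := by
    have := hmeas (P.map X) univ
    simp only [univ_inter, measure_univ] at this
    exact this.eventually_ne one_ne_zero
  have hleft : Tendsto (fun k => P (D ∩ X ⁻¹' (A ∩ B k))) atTop (𝓝 (P (D ∩ X ⁻¹' A))) := by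
    have := tendsto_measure_iUnion_atTop (μ := P) (s := fun k => D ∩ X ⁻¹' (A ∩ B k))
      fun k l hkl => inter_subset_inter_right D
        (preimage_mono (inter_subset_inter_right A (hBmono hkl)))
    rwa [← inter_iUnion, ← preimage_iUnion, ← inter_iUnion, hBU, inter_univ] at this
  have hright : Tendsto (fun k => ∫⁻ ω in D, (X ⁻¹' B k).indicator (fun ω =>
      (∫⁻ x in A ∩ B k, ENNReal.ofReal (weight X σ β J t ω x) ∂(P.map X)) /
        (∫⁻ x in B k, ENNReal.ofReal (weight X σ β J t ω x) ∂(P.map X))) ω ∂P) atTop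
      (𝓝 (∫⁻ ω in D, posterior P X σ β J t ω A ∂P)) := by
    refine tendsto_lintegral_of_dominated_convergence (fun _ => 1) (fun k => ?_) (fun k => ?_) ?_ ?_
    · exact ((hS.measurable_setLIntegral_weight ht _).div
        (hS.measurable_setLIntegral_weight ht _)).indicator (hS.measurable_signal (hBm k))
    · refine ae_of_all _ fun ω => ?_
      exact (indicator_le_self _ _ ω).trans (setLIntegral_weight_div_le_one t ω A (B k))
    · rw [lintegral_one]
      exact measure_ne_top _ _
    · filter_upwards [ae_restrict_of_ae (hS.ae_normalizer ht)] with ω hω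
      have hw : ∀ C : Set 𝕏, MeasurableSet C →
          ∫⁻ x in C, ENNReal.ofReal (weight X σ β J t ω x) ∂(P.map X) =
          ((P.map X).withDensity fun x => ENNReal.ofReal (weight X σ β J t ω x)) C :=
        fun C hC => (withDensity_apply _ hC).symm
      have hnum := hmeas ((P.map X).withDensity fun x => ENNReal.ofReal (weight X σ β J t ω x)) A
      have hden := hmeas ((P.map X).withDensity fun x => ENNReal.ofReal (weight X σ β J t ω x)) univ
      simp only [univ_inter] at hden
      simp only [← hw _ (hA.inter (hBm _)), ← hw _ (hBm _), ← hw _ hA,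
        ← hw _ MeasurableSet.univ, setLIntegral_univ] at hnum hden
      have hpost : posterior P X σ β J t ω A =
          (∫⁻ x in A, ENNReal.ofReal (weight X σ β J t ω x) ∂(P.map X)) /
            ∫⁻ x, ENNReal.ofReal (weight X σ β J t ω x) ∂(P.map X) := by
        rw [posterior_apply t ω hA, mul_comm, ← div_eq_mul_inv]
        rfl
      rw [hpost]
      refine (ENNReal.Tendsto.div hnum (Or.inr hω.1) hden (Or.inr ?_)).congr' ?_
      · exact ((setLIntegral_le_lintegral A _).trans_lt (lt_top_iff_ne_top.2 hω.2)).ne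
      -- The indicator equals `1` as soon as `k ≥ |X ω|`.
      · filter_upwards [hBev (X ω)] with k hk
        rw [indicator_of_mem (show ω ∈ X ⁻¹' B k from hk)]
  refine tendsto_nhds_unique hright (hleft.congr' ?_)
  filter_upwards [hB0] with k hk
  rw [hS.measure_inter_preimage_usualAugmentation ht hA (hBm k) (K := k) (fun x hx => hx) hk hD,
    setLIntegral_indicator (hS.measurable_signal (hBm k)), inter_comm]

theorem isCondLaw_usualAugmentation [IsProbabilityMeasure P] (hS : IsModulatedSystem P X σ β J)
    {t : unitInterval} (ht : t < 1) :
    IsCondLaw P X (usualAugmentation P (observed X σ β J) t) (posterior P X σ β J t) := by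
  have hle : usualAugmentation P (observed X σ β J) t ≤ ‹MeasurableSpace Ω› :=
    inf_le_left.trans (sup_le (hS.observed_le_ambient 1) (nullEvents_le P))
  have hge : observed X σ β J t ≤ usualAugmentation P (observed X σ β J) t :=
    le_inf ((observed_mono X σ β J ht le_top).trans le_sup_left)
      (le_iInf₂ fun s hs => (observed_mono X σ β J ht hs.le).trans le_sup_left)
  refine isCondLaw_of_setLIntegral hS.measurable_signal hle
    (hS.ae_isProbabilityMeasure_posterior ht) (fun A hA => ?_)
    fun A hA D hD => hS.setLIntegral_posterior_usualAugmentation ht hA hD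
  obtain ⟨g, hg, hgP⟩ := hS.exists_measurable_posterior_observed ht hA
  exact ⟨g, hg.mono hge le_rfl, hgP⟩

end IsModulatedSystem

end ModulatedInformation
open ModulatedInformation in
theorem mainTheorem4 {Ω : Type*} [MeasurableSpace Ω] (P : Measure Ω) [IsProbabilityMeasure P]
    {𝕏 : Set ℝ} {n : ℕ} (X : Ω → 𝕏) (σ : Fin n → ℝ) (β : Fin n → unitInterval → Ω → ℝ)
    (J : unitInterval → Ω → Fin n → Bool) (hS : IsModulatedSystem P X σ β J)
    (t : unitInterval) (ht : t < 1) :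
    -- the normalising integral is a.s. positive and finite
    (∀ᵐ ω ∂P, normalizer P X σ β J t ω ≠ 0 ∧ normalizer P X σ β J t ω ≠ ∞) ∧
    -- the law of `X` given `F_t`, for the generated σ-algebra and for its usual augmentation
    IsCondLaw P X (observed X σ β J t) (posterior P X σ β J t) ∧
    IsCondLaw P X (usualAugmentation P (observed X σ β J) t) (posterior P X σ β J t) ∧
    -- it is also the law of `X` given the effective information with its volatility parameter
    -- and the complementary information
    IsCondLaw P X
      (effCompInfo X σ β J t ⊔ MeasurableSpace.comap (fun ω => effVol σ (J t ω)) inferInstance)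
      (posterior P X σ β J t) ∧
    -- in particular: given the current configuration `J_t = k`, or if the volatility parameter is
    -- a.s. determined, the effective and complementary information suffice
    (∀ k : Fin n → Bool, P (J t ⁻¹' {k}) ≠ 0 →
      IsCondLaw (P[|J t ⁻¹' {k}]) X (effCompInfo X σ β J t) (posterior P X σ β J t)) ∧
    (∀ v : Ω → ℝ, Measurable[effCompInfo X σ β J t] v →
      (fun ω => effVol σ (J t ω)) =ᵐ[P] v →
      IsCondLaw P X (effCompInfo X σ β J t) (posterior P X σ β J t)) :=
  ⟨hS.ae_normalizer ht, hS.isCondLaw_observed ht, hS.isCondLaw_usualAugmentation ht,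
    hS.isCondLaw_effCompInfo_sup ht, fun _ hk => hS.isCondLaw_cond_effCompInfo ht hk,
    fun _ hv hev => hS.isCondLaw_effCompInfo ht hv hev⟩
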